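/- **Setting.** $HA_2$ is the following theory in deduction modulo. There are a sort $\iota$ and sorts $\kappa_n$ ($n\ge 0$), with infinitely many variables of each sort; function symbols $0$, $S$, $\mathit{Pred}$; predicate symbols $=$, $N$, $\mathit{Null}$, $\epsilon_n$; and, for every proposition $B$ without Skolem symbols whose free variables are among the distinct variables $x_1,\dots,x_p$ (of sort $\iota$) and $y_1,\dots,y_n$, a Skolem symbol $f_{\langle x_1..x_p\rangle,\langle y_1..y_n\rangle,B}$ of target sort $\kappa_p$. Propositions are built from atoms with $\Rightarrow$ and $\forall$, up to renaming of bound variables. The congruence $\equiv$ is generated by the rewrite rules $x_1,\dots,x_p\,\epsilon_p\,f_{\langle x_1..x_p\rangle,\langle y_1..y_n\rangle,B}(y_1,\dots,y_n)\to B$; $x=y\to\forall c\,(x\,\epsilon_1 c\Rightarrow y\,\epsilon_1 c)$; $N(x)\to\forall c\,(0\,\epsilon_1 c\Rightarrow\forall y\,(N(y)\Rightarrow y\,\epsilon_1 c\Rightarrow S(y)\,\epsilon_1 c)\Rightarrow x\,\epsilon_1 c)$; $\mathit{Null}(0)\to\forall c\,(\epsilon_0(c)\Rightarrow\epsilon_0(c))$;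 $\mathit{Null}(S(x))\to\forall c\,\epsilon_0(c)$; $\mathit{Pred}(0)\to 0$; $\mathit{Pred}(S(x))\to x$. Put $\exists x\,A=\forall c\,((\forall x\,(A\Rightarrow\epsilon_0(c)))\Rightarrow\epsilon_0(c))$, with $c$ not free in $A$. Schemes are $t=[A]\mid\lambda_A t\mid(t\,t')\mid\Lambda x\,t\mid(t\,a)$, where $[A]$ is the canonical variable of type $A$. They are typed in finite sets $\Gamma$ of propositions by the rules of natural deduction and the conversion rule: $\Gamma\vdash[A]:A$ if $A\in\Gamma$; $\Gamma\vdash\lambda_A t:A\Rightarrow B$ if $\Gamma\cup\{A\}\vdash t:B$; $\Gamma\vdash(t\,u):B$ if $\Gamma\vdash t:A\Rightarrow B$ and $\Gamma\vdash u:A$; $\Gamma\vdash\Lambda x\,t:\forall x\,A$ if $\Gamma\vdash t:A$ and $x\notin FV(\Gamma)$; $\Gamma\vdash(t\,a):[a/x]A$ if $\Gamma\vdash t:\forall x\,A$; and $\Gamma\vdash t:B$ if $\Gamma\vdash t:A$ and $A\equiv B$. The set $[w/A]_\Gamma t$ consists of the results of replacing canonical variables $[A]$ in $t$ by $w$, where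 the replacement is optional at an occurrence if $A$ belongs to $\Gamma$ extended by the types $B$ of the enclosing $\lambda_B$, and forced otherwise; bound term variables are renamed so as not to occur in $w$, $A$, $\Gamma$. The minimal substitution $\underline{[w/A]}_\Gamma t$ is the element of this set in which only the forced replacements are made. The $\beta$-reduction $\rhd^*$ of schemes in a context $\Gamma$ is generated, in all contexts of schemes ($\Gamma$ being extended by $B$ under $\lambda_B$), by $((\lambda_A t)\,u)\to v$ for $v\in[u/A]_\Gamma t$, and $((\Lambda x\,t)\,a)\to[a/x]t$. Weak minimal reduction uses $\underline{[u/A]}_\Gamma t$ instead, and reduces only at the root and to the left of applications; a weak normal form of a scheme is an irreducible scheme obtained from it by weak minimal reduction. **Proposition (Witness property).** Let $\exists x\,A$ be a closed proposition of $HA_2$ and let $t$ be a scheme of type $\exists x\,A$ in the empty context. Then there are a term $b$, of the sort of $x$, and a scheme of type $[b/x]A$ in the empty context. They are extracted from $t$ as follows. There are a class term $e$ of sort $\kappa_0$ with $\epsilon_0(e)\equiv\exists x\,A$ and a scheme $w$ of type $\forall x\,(A\Rightarrow\exists x\,A)$ in the empty context. Let $c$ be any variable of sort $\kappa_0$, $G=\forall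 x\,(A\Rightarrow\epsilon_0(c))$ and $g=[G]$. In the context $\{G\}$: 1. $(t\,c\,g)$ $\beta$-reduces to some scheme of the form $(g\,a\,u)$; 2. every weak normal form of $(t\,c\,g)$ has the form $(g\,a\,u)$; 3. whenever $(t\,c\,g)$ $\beta$-reduces to $(g\,a\,u)$, in particular whenever $(g\,a\,u)$ is its weak normal form, $u$ has type $[a/x]A$ in the context $\{G\}$; and then, for all $e$ and $w$ as above, with $b=[e/c]a$, the scheme $v=\underline{[w/\forall x\,(A\Rightarrow\epsilon_0(e))]}_{\varnothing}\,[e/c]u$ has type $[b/x]A$ in the empty context. -/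

import Mathlib

namespace SchemeHA2

/-! ## Sorts, terms and propositions

Variables of each sort are numbered by the natural numbers.  A binder of sort `s` binds the
variable `0` of sort `s` in its body (de Bruijn style, with one numbering per sort); thus
alphabetically equivalent expressions are equal. -/

/-- The sort `ι` of numbers and the sorts `κ_n` of `n`-ary classes of numbers. -/
inductive Srt : Type
  | iota : Srt
  | kappa (n : ℕ) : Srt
  deriving DecidableEq

/-- A family of class-valued function symbols: `f` has arity
`⟨par f 0, …, par f (len f - 1), κ_(cls f)⟩`. -/
structure ClassSig : Type 1 where
  Sym : Type
  cls : Sym → ℕ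
  len : Sym → ℕ
  par : (f : Sym) → Fin (len f) → Srt

/-- Well-sorted terms over `0`, `S`, `Pred` and the class symbols of the signature. -/
inductive Term (L : ClassSig) : Srt → Type
  | var (s : Srt) (k : ℕ) : Term L s
  | zero : Term L .iota
  | succ (a : Term L .iota) : Term L .iota
  | pred (a : Term L .iota) : Term L .iota
  | fn (f : L.Sym) (b : (j : Fin (L.len f)) → Term L (L.par f j)) : Term L (.kappa (L.cls f))

/-- Propositions (types): `a = b`, `N(a)`, `Null(a)`, `a₁, …, aₙ ε_n c`, `A ⇒ B`, `∀x A`. -/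
inductive Form (L : ClassSig) : Type
  | eq (a b : Term L .iota) : Form L
  | nat (a : Term L .iota) : Form L
  | null (a : Term L .iota) : Form L
  | eps (n : ℕ) (a : Fin n → Term L .iota) (c : Term L (.kappa n)) : Form L
  | imp (A B : Form L) : Form L
  | all (s : Srt) (A : Form L) : Form L

/-! ### Renamings and substitutions of term variables -/

/-- Renamings of variables, sort by sort. -/
abbrev Ren : Type := Srt → ℕ → ℕ

/-- The renaming that makes the variable `0` of sort `s` fresh. -/
def Ren.shift (s : Srt) : Ren := fun s' k => if s' = s then k + 1 else k

/-- The renaming `ρ` carried under a binder of sort `s`. -/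
def Ren.up (s : Srt) (ρ : Ren) : Ren := fun s' k =>
  if s' = s then (match k with
    | 0 => 0
    | k + 1 => ρ s' k + 1)
  else ρ s' k

section Generic

variable {L : ClassSig}

def Term.rename (ρ : Ren) : {s : Srt} → Term L s → Term L s
  | _, .var s k => .var s (ρ s k)
  | _, .zero => .zero
  | _, .succ a => .succ (a.rename ρ)
  | _, .pred a => .pred (a.rename ρ)
  | _, .fn f b => .fn f (fun j => (b j).rename ρ)

def Form.rename : Ren → Form L → Form L
  | ρ, .eq a b => .eq (a.rename ρ) (b.rename ρ)
  | ρ, .nat a => .nat (a.rename ρ)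
  | ρ, .null a => .null (a.rename ρ)
  | ρ, .eps n a c => .eps n (fun i => (a i).rename ρ) (c.rename ρ)
  | ρ, .imp A B => .imp (A.rename ρ) (B.rename ρ)
  | ρ, .all s A => .all s (A.rename (Ren.up s ρ))

/-- Weakening: `a` in the scope of one more variable of sort `s`. -/
def Term.shift (s : Srt) {s' : Srt} (a : Term L s') : Term L s' := a.rename (Ren.shift s)

/-- Weakening: `A` in the scope of one more variable of sort `s`. -/
def Form.shift (s : Srt) (A : Form L) : Form L := A.rename (Ren.shift s)

/-- Simultaneous well-sorted substitutions of term variables. -/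
abbrev Subst (L : ClassSig) : Type := (s : Srt) → ℕ → Term L s

/-- The substitution `θ` carried under a binder of sort `s`. -/
def Subst.up (s : Srt) (θ : Subst L) : Subst L := fun s' k =>
  if s' = s then (match k with
    | 0 => .var s' 0
    | k + 1 => (θ s' k).shift s)
  else (θ s' k).shift s

/-- The substitution `[a/x]` where `x`, the variable `0` of sort `s`, is the variable of a binder
that is removed. -/
def Subst.inst {s : Srt} (a : Term L s) : Subst L := fun s' k =>
  if h : s' = s then (match k with
    | 0 => h ▸ a
    | k + 1 => .var s' k)
  else .var s' k

/-- The substitution `[e/c]` where `c` is the free variable number `k` of sort `s`; all other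
variables are left in place. -/
def Subst.single {s : Srt} (k : ℕ) (e : Term L s) : Subst L := fun s' k' =>
  if h : s' = s then (if k' = k then h ▸ e else .var s' k') else .var s' k'

def Term.subst (θ : Subst L) : {s : Srt} → Term L s → Term L s
  | _, .var s k => θ s k
  | _, .zero => .zero
  | _, .succ a => .succ (a.subst θ)
  | _, .pred a => .pred (a.subst θ)
  | _, .fn f b => .fn f (fun j => (b j).subst θ)

def Form.subst : Subst L → Form L → Form L
  | θ, .eq a b => .eq (a.subst θ) (b.subst θ)
  | θ, .nat a => .nat (a.subst θ)
  | θ, .null a => .null (a.subst θ)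
  | θ, .eps n a c => .eps n (fun i => (a i).subst θ) (c.subst θ)
  | θ, .imp A B => .imp (A.subst θ) (B.subst θ)
  | θ, .all s A => .all s (A.subst (Subst.up s θ))

/-- `[a/x]A` for the body `A` of a quantifier `∀x` (or `∃x`) over the sort of `a`. -/
def Form.inst {s : Srt} (A : Form L) (a : Term L s) : Form L := A.subst (Subst.inst a)

/-- The variable number `k` of sort `s` occurs in the term. -/
def Term.HasFree (s : Srt) (k : ℕ) : {s' : Srt} → Term L s' → Prop
  | _, .var s' k' => s' = s ∧ k' = k
  | _, .zero => False
  | _, .succ a => a.HasFree s k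
  | _, .pred a => a.HasFree s k
  | _, .fn _ b => ∃ j, (b j).HasFree s k

/-- The variable number `k` of sort `s` occurs free in the proposition. -/
def Form.HasFree (s : Srt) : ℕ → Form L → Prop
  | k, .eq a b => a.HasFree s k ∨ b.HasFree s k
  | k, .nat a => a.HasFree s k
  | k, .null a => a.HasFree s k
  | k, .eps _ a c => (∃ i, (a i).HasFree s k) ∨ c.HasFree s k
  | k, .imp A B => A.HasFree s k ∨ B.HasFree s k
  | k, .all s' A => A.HasFree s (if s = s' then k + 1 else k)

/-- A proposition without free variables. -/
def Form.Closed (A : Form L) : Prop := ∀ s k, ¬ A.HasFree s k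

/-- `ε_0(c)`. -/
def Form.eps0 (c : Term L (.kappa 0)) : Form L := .eps 0 (fun i => i.elim0) c

/-- `a ε_1 c`. -/
def Form.eps1 (a : Term L .iota) (c : Term L (.kappa 1)) : Form L := .eps 1 (fun _ => a) c

/-- `⊤ = ∀c (ε_0(c) ⇒ ε_0(c))`. -/
def Form.top : Form L := .all (.kappa 0) (.imp (.eps0 (.var _ 0)) (.eps0 (.var _ 0)))

/-- `⊥ = ∀c ε_0(c)`. -/
def Form.bot : Form L := .all (.kappa 0) (.eps0 (.var _ 0))

/-- `∀x (A ⇒ D)` where `x`, of sort `s`, may occur in `A` and does not occur in `D`. -/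
def Form.allImp (s : Srt) (A D : Form L) : Form L := .all s (.imp A (D.shift s))

/-- `∃x A = ∀c ((∀x (A ⇒ ε_0(c))) ⇒ ε_0(c))`, with `x` of sort `s` and `c` not in `A`. -/
def Form.ex (s : Srt) (A : Form L) : Form L :=
  .all (.kappa 0)
    (.imp (.allImp s (A.rename (Ren.up s (Ren.shift (.kappa 0)))) (.eps0 (.var _ 0)))
      (.eps0 (.var _ 0)))

end Generic

/-! ## The theory HA₂ -/

/-- The language without Skolem symbols. -/
def baseSig : ClassSig where
  Sym := Empty
  cls := Empty.elim
  len := Empty.elim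
  par := fun f => f.elim

/-- The Skolem symbols `f_{⟨x₁,…,x_p⟩,⟨y₁,…,y_n⟩,A}`: pairwise distinct variables `x₁,…,x_p` of
sort `ι` and `y₁,…,y_n` of any sorts, and a proposition `A` without Skolem symbols whose free
variables are among them. -/
structure SkolemSym : Type where
  p : ℕ
  n : ℕ
  x : Fin p → ℕ
  ySort : Fin n → Srt
  y : Fin n → ℕ
  body : Form baseSig
  distinct : Function.Injective
    (Sum.elim (fun i => (Srt.iota, x i)) (fun j => (ySort j, y j)) : Fin p ⊕ Fin n → Srt × ℕ)
  free : ∀ s k, body.HasFree s k →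
    (∃ i, (Srt.iota, x i) = (s, k)) ∨ (∃ j, (ySort j, y j) = (s, k))

/-- The language of HA₂. -/
def haSig : ClassSig where
  Sym := SkolemSym
  cls := SkolemSym.p
  len := SkolemSym.n
  par := SkolemSym.ySort

/-- Terms of HA₂ of sort `s`. -/
abbrev Tm (s : Srt) : Type := Term haSig s

/-- Propositions of HA₂. -/
abbrev Fm : Type := Form haSig

/-- The inclusion of the language without Skolem symbols in the language of HA₂. -/
def Term.embed : {s : Srt} → Term baseSig s → Tm s
  | _, .var s k => .var s k
  | _, .zero => .zero
  | _, .succ a => .succ a.embed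
  | _, .pred a => .pred a.embed
  | _, .fn f _ => Empty.elim f

/-- The inclusion of the language without Skolem symbols in the language of HA₂. -/
def Form.embed : Form baseSig → Fm
  | .eq a b => .eq a.embed b.embed
  | .nat a => .nat a.embed
  | .null a => .null a.embed
  | .eps n a c => .eps n (fun i => (a i).embed) c.embed
  | .imp A B => .imp A.embed B.embed
  | .all s A => .all s A.embed

/-- All instances of the rewrite rules on terms. -/
inductive TermRule : Tm .iota → Tm .iota → Prop
  | pred_zero : TermRule (.pred .zero) .zero
  | pred_succ (a : Tm .iota) : TermRule (.pred (.succ a)) a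

/-- All instances of the rewrite rules on propositions. -/
inductive FormRule : Fm → Fm → Prop
  /-- `x₁,…,x_p ε_p f(y₁,…,y_n) ⟶ A`, instantiated by `θ`. -/
  | skolem (f : SkolemSym) (θ : Subst haSig) :
      FormRule
        (.eps f.p (fun i => θ .iota (f.x i))
          (Term.fn (L := haSig) f (fun j => θ (f.ySort j) (f.y j))))
        (f.body.embed.subst θ)
  /-- `a = b ⟶ ∀c (a ε_1 c ⇒ b ε_1 c)`. -/
  | eq (a b : Tm .iota) :
      FormRule (.eq a b)
        (.all (.kappa 1)
          (.imp (.eps1 (a.shift (.kappa 1)) (.var _ 0)) (.eps1 (b.shift (.kappa 1)) (.var _ 0))))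
  /-- `N(a) ⟶ ∀c (0 ε_1 c ⇒ ∀y (N(y) ⇒ y ε_1 c ⇒ S(y) ε_1 c) ⇒ a ε_1 c)`. -/
  | nat (a : Tm .iota) :
      FormRule (.nat a)
        (.all (.kappa 1)
          (.imp (.eps1 .zero (.var _ 0))
            (.imp
              (.all .iota
                (.imp (.nat (.var _ 0))
                  (.imp (.eps1 (.var _ 0) (.var _ 0)) (.eps1 (.succ (.var _ 0)) (.var _ 0)))))
              (.eps1 (a.shift (.kappa 1)) (.var _ 0)))))
  | null_zero : FormRule (.null .zero) .top
  | null_succ (a : Tm .iota) : FormRule (.null (.succ a)) .bot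

/-- The congruence on terms generated by the rewrite rules. -/
inductive TermCongr : {s : Srt} → Tm s → Tm s → Prop
  | rule {a b : Tm .iota} : TermRule a b → TermCongr a b
  | refl {s : Srt} (a : Tm s) : TermCongr a a
  | symm {s : Srt} {a b : Tm s} : TermCongr a b → TermCongr b a
  | trans {s : Srt} {a b c : Tm s} : TermCongr a b → TermCongr b c → TermCongr a c
  | succ {a b : Tm .iota} : TermCongr a b → TermCongr (.succ a) (.succ b)
  | pred {a b : Tm .iota} : TermCongr a b → TermCongr (.pred a) (.pred b)
  | fn (f : haSig.Sym) {b b' : (j : Fin (haSig.len f)) → Tm (haSig.par f j)} :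
      (∀ j, TermCongr (b j) (b' j)) → TermCongr (.fn f b) (.fn f b')

/-- The congruence `≡` on propositions generated by the rewrite rules. -/
inductive FormCongr : Fm → Fm → Prop
  | rule {A B : Fm} : FormRule A B → FormCongr A B
  | refl (A : Fm) : FormCongr A A
  | symm {A B : Fm} : FormCongr A B → FormCongr B A
  | trans {A B C : Fm} : FormCongr A B → FormCongr B C → FormCongr A C
  | eq {a a' b b' : Tm .iota} : TermCongr a a' → TermCongr b b' →
      FormCongr (.eq a b) (.eq a' b')
  | nat {a a' : Tm .iota} : TermCongr a a' → FormCongr (.nat a) (.nat a')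
  | null {a a' : Tm .iota} : TermCongr a a' → FormCongr (.null a) (.null a')
  | eps (n : ℕ) {a a' : Fin n → Tm .iota} {c c' : Tm (.kappa n)} :
      (∀ i, TermCongr (a i) (a' i)) → TermCongr c c' → FormCongr (.eps n a c) (.eps n a' c')
  | imp {A A' B B' : Fm} : FormCongr A A' → FormCongr B B' → FormCongr (.imp A B) (.imp A' B')
  | all (s : Srt) {A A' : Fm} : FormCongr A A' → FormCongr (.all s A) (.all s A')

/-! ## Schemes and their typing -/

noncomputable instance : DecidableEq Fm := Classical.decEq _

/-- Contexts are finite sets of types. -/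
abbrev Ctx : Type := Finset Fm

/-- Schemes: the canonical variable of type `A`, `λ_A t`, `(t u)`, `Λx t`, `(t a)`. -/
inductive Scheme : Type
  | var (A : Fm) : Scheme
  | lam (A : Fm) (t : Scheme) : Scheme
  | app (t u : Scheme) : Scheme
  | tlam (s : Srt) (t : Scheme) : Scheme
  | tapp {s : Srt} (t : Scheme) (a : Tm s) : Scheme

noncomputable def Ctx.shift (s : Srt) (Γ : Ctx) : Ctx := Γ.image (Form.shift s)

def Scheme.rename : Ren → Scheme → Scheme
  | ρ, .var A => .var (A.rename ρ)
  | ρ, .lam A t => .lam (A.rename ρ) (t.rename ρ)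
  | ρ, .app t u => .app (t.rename ρ) (u.rename ρ)
  | ρ, .tlam s t => .tlam s (t.rename (Ren.up s ρ))
  | ρ, .tapp t a => .tapp (t.rename ρ) (a.rename ρ)

/-- Weakening: `t` in the scope of one more term variable of sort `s`. -/
def Scheme.shift (s : Srt) (t : Scheme) : Scheme := t.rename (Ren.shift s)

/-- The application `θ t` of a substitution of term variables to a scheme. -/
def Scheme.subst : Subst haSig → Scheme → Scheme
  | θ, .var A => .var (A.subst θ)
  | θ, .lam A t => .lam (A.subst θ) (t.subst θ)
  | θ, .app t u => .app (t.subst θ) (u.subst θ)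
  | θ, .tlam s t => .tlam s (t.subst (Subst.up s θ))
  | θ, .tapp t a => .tapp (t.subst θ) (a.subst θ)

/-- `[a/x]t` for the body `t` of an abstraction `Λx` over the sort of `a`. -/
def Scheme.inst {s : Srt} (t : Scheme) (a : Tm s) : Scheme := t.subst (Subst.inst a)

/-- `Γ ⊢ t : A` in HA₂.  In the rule for `Λx` the context is weakened, which expresses that
`x` is not free in it. -/
inductive HasType : Ctx → Scheme → Fm → Prop
  | ax {Γ : Ctx} {A : Fm} : A ∈ Γ → HasType Γ (.var A) A
  | lam {Γ : Ctx} {A B : Fm} {t : Scheme} :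
      HasType (Γ ∪ {A}) t B → HasType Γ (.lam A t) (.imp A B)
  | app {Γ : Ctx} {A B : Fm} {t u : Scheme} :
      HasType Γ t (.imp A B) → HasType Γ u A → HasType Γ (.app t u) B
  | tlam {Γ : Ctx} {s : Srt} {A : Fm} {t : Scheme} :
      HasType (Ctx.shift s Γ) t A → HasType Γ (.tlam s t) (.all s A)
  | tapp {Γ : Ctx} {s : Srt} {A : Fm} {t : Scheme} (a : Tm s) :
      HasType Γ t (.all s A) → HasType Γ (.tapp t a) (A.inst a)
  | conv {Γ : Ctx} {A B : Fm} {t : Scheme} :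
      HasType Γ t A → FormCongr A B → HasType Γ t B

/-! ## Substitution of scheme variables and reduction -/

/-- `t.gsubst w A Γ` is the set `[w/A]_Γ t`: a variable of type `A` may be left in place if `A`
is in the current context, and has to be replaced by `w` otherwise. -/
def Scheme.gsubst : Scheme → Scheme → Fm → Ctx → Set Scheme
  | .var B, w, A, Γ => {v | (B = A ∧ v = w) ∨ ((B ≠ A ∨ A ∈ Γ) ∧ v = .var B)}
  | .lam B t, w, A, Γ => Scheme.lam B '' t.gsubst w A (Γ ∪ {B})
  | .app t u, w, A, Γ => Set.image2 Scheme.app (t.gsubst w A Γ) (u.gsubst w A Γ)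
  | .tlam s t, w, A, Γ =>
      Scheme.tlam s '' t.gsubst (w.shift s) (A.shift s) (Ctx.shift s Γ)
  | .tapp t a, w, A, Γ => (fun t' => Scheme.tapp t' a) '' t.gsubst w A Γ

/-- The minimal substitution: a variable of type `A` is replaced by `w` only if `A` is not in the
current context. -/
noncomputable def Scheme.minSubst : Scheme → Scheme → Fm → Ctx → Scheme
  | .var B, w, A, Γ => if B = A ∧ A ∉ Γ then w else .var B
  | .lam B t, w, A, Γ => .lam B (t.minSubst w A (Γ ∪ {B}))
  | .app t u, w, A, Γ => .app (t.minSubst w A Γ) (u.minSubst w A Γ)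
  | .tlam s t, w, A, Γ => .tlam s (t.minSubst (w.shift s) (A.shift s) (Ctx.shift s Γ))
  | .tapp t a, w, A, Γ => .tapp (t.minSubst w A Γ) a

/-- One step of β-reduction of schemes in the context `Γ`. -/
inductive BetaStep : Ctx → Scheme → Scheme → Prop
  | beta {Γ : Ctx} {A : Fm} {t u v : Scheme} :
      v ∈ t.gsubst u A Γ → BetaStep Γ (.app (.lam A t) u) v
  | tbeta {Γ : Ctx} {s : Srt} {t : Scheme} (a : Tm s) :
      BetaStep Γ (.tapp (.tlam s t) a) (t.inst a)
  | appL {Γ : Ctx} {t t' u : Scheme} : BetaStep Γ t t' → BetaStep Γ (.app t u) (.app t' u)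
  | appR {Γ : Ctx} {t u u' : Scheme} : BetaStep Γ u u' → BetaStep Γ (.app t u) (.app t u')
  | lam {Γ : Ctx} {A : Fm} {t t' : Scheme} :
      BetaStep (Γ ∪ {A}) t t' → BetaStep Γ (.lam A t) (.lam A t')
  | tlam {Γ : Ctx} {s : Srt} {t t' : Scheme} :
      BetaStep (Ctx.shift s Γ) t t' → BetaStep Γ (.tlam s t) (.tlam s t')
  | tapp {Γ : Ctx} {s : Srt} {t t' : Scheme} (a : Tm s) :
      BetaStep Γ t t' → BetaStep Γ (.tapp t a) (.tapp t' a)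

/-- β-reduction in the context `Γ`. -/
def BetaRed (Γ : Ctx) : Scheme → Scheme → Prop := Relation.ReflTransGen (BetaStep Γ)

/-- One step of weak minimal reduction of schemes in the context `Γ`. -/
inductive WeakStep (Γ : Ctx) : Scheme → Scheme → Prop
  | beta {A : Fm} {t u : Scheme} : WeakStep Γ (.app (.lam A t) u) (t.minSubst u A Γ)
  | tbeta {s : Srt} {t : Scheme} (a : Tm s) : WeakStep Γ (.tapp (.tlam s t) a) (t.inst a)
  | app {t t' u : Scheme} : WeakStep Γ t t' → WeakStep Γ (.app t u) (.app t' u)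
  | tapp {s : Srt} {t t' : Scheme} (a : Tm s) :
      WeakStep Γ t t' → WeakStep Γ (.tapp t a) (.tapp t' a)

/-- Weak minimal reduction in the context `Γ`. -/
def WeakRed (Γ : Ctx) : Scheme → Scheme → Prop := Relation.ReflTransGen (WeakStep Γ)

/-- `n` is a weak normal form of `t` in the context `Γ`. -/
def IsWeakNF (Γ : Ctx) (t n : Scheme) : Prop := WeakRed Γ t n ∧ ∀ n', ¬ WeakStep Γ n n'

end SchemeHA2

/-!
Typing is preserved by β-reduction, whichever optional replacements are made (`HasType.gsubst`,
`BetaStep.hasType`).  This rests on the injectivity of `⇒` and `∀` for the congruence.  Up to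
congruence of terms, which is decided by the normal form for `Pred`, each atom has at most one
unfolding (`FormRule.coherent`), so that parallel unfolding has the diamond property
(`Par.diamond`); moreover `ε_0(c)` is irreducible for a variable `c`.  Hence a scheme of type
`ε_0(c)` in the context `G = ∀x (A ⇒ ε_0(c))` that is irreducible for weak minimal reduction is of
the form `(g a u)` (`HasType.weak_normal_eps0`), and `u` has type `[a/x]A` (`HasType.witness`).

That `(t c g)` reduces to such a scheme needs no normalization theorem.  Propositions are
interpreted by sets of schemes closed under β-expansion: numbers by natural numbers, classes by
arbitrary functions from numbers to such sets, `N` by a least fixed point, and Skolem symbols by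
the classes which they name.  All rules are valid in this model (`FormCongr.sem_eq`), and every
closed scheme belongs to the value of its type (`HasType.mem_sem`).  When the class variable bound
in `∃x A` has as value the set of schemes that reduce to some `(g a u)`, the scheme `g` is in the
value of `∀x (A ⇒ ε_0(c))` by definition, and therefore `(t c g)` is in this set
(`HasType.betaRed_witness`).

A term substitution may identify the types of two canonical variables whose values in the model
differ.  Minimal substitution would then confuse these variables, but β-reduction may choose which
optional replacements to make.  The relation `Scheme.Inst` therefore remembers the types that the
variables have before the substitution, and `Scheme.Inst.exists_gsubst` finds the replacements
that respect the binding structure.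

The class `e` exists because every proposition is congruent to one without Skolem symbols
(`Form.exists_embed_congr`), obtained by unfolding the Skolem symbols from the outside in.
-/

namespace SchemeHA2

/-! ### Substitution of term variables -/

section Generic

variable {L : ClassSig}

/-- The substitution that replaces variables according to a renaming. -/
def Subst.ofRen (ρ : Ren) : Subst L := fun s k => .var s (ρ s k)

/-- The substitution `θ` followed by `τ`. -/
def Subst.comp (θ τ : Subst L) : Subst L := fun s k => (θ s k).subst τ

/-- `θ` extended by `a` for a new variable `0` of sort `s`. -/
def Subst.cons {s : Srt} (θ : Subst L) (a : Term L s) : Subst L := (θ.up s).comp (Subst.inst a)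

theorem Term.rename_eq_subst (ρ : Ren) {s : Srt} (a : Term L s) :
    a.rename ρ = a.subst (Subst.ofRen ρ) := by
  induction a <;> simp_all [Term.rename, Term.subst, Subst.ofRen]

theorem Term.subst_subst (θ τ : Subst L) {s : Srt} (a : Term L s) :
    (a.subst θ).subst τ = a.subst (θ.comp τ) := by
  induction a <;> simp_all [Term.subst, Subst.comp]

theorem Term.subst_var {s : Srt} (a : Term L s) : a.subst (fun s k => .var s k) = a := by
  induction a <;> simp_all [Term.subst]

theorem Term.shift_eq_subst (s : Srt) {s' : Srt} (a : Term L s') :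
    a.shift s = a.subst (Subst.ofRen (Ren.shift s)) :=
  Term.rename_eq_subst _ a

theorem Subst.up_ofRen (s : Srt) (ρ : Ren) :
    Subst.up s (Subst.ofRen ρ : Subst L) = Subst.ofRen (Ren.up s ρ) := by
  funext s' k
  by_cases h : s' = s
  · cases k <;> simp [Subst.up, Subst.ofRen, Ren.up, Ren.shift, Term.shift, Term.rename, h]
  · simp [Subst.up, Subst.ofRen, Ren.up, Ren.shift, Term.shift, Term.rename, h]

theorem Subst.ofRen_shift_comp_up (s : Srt) (τ : Subst L) :
    (Subst.ofRen (Ren.shift s)).comp (τ.up s) = τ.comp (Subst.ofRen (Ren.shift s)) := by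
  funext s' k
  by_cases h : s' = s
  · simp [Subst.up, Subst.ofRen, Subst.comp, Ren.shift, Term.shift_eq_subst, Term.subst, h]
  · simp [Subst.up, Subst.ofRen, Subst.comp, Ren.shift, Term.shift_eq_subst, Term.subst, h]

theorem Term.shift_subst_up (s : Srt) (τ : Subst L) {s' : Srt} (a : Term L s') :
    (a.shift s).subst (τ.up s) = (a.subst τ).shift s := by
  rw [Term.shift_eq_subst, Term.shift_eq_subst, Term.subst_subst, Term.subst_subst,
    Subst.ofRen_shift_comp_up]

theorem Subst.up_comp (s : Srt) (θ τ : Subst L) :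
    (θ.up s).comp (τ.up s) = (θ.comp τ).up s := by
  funext s' k
  by_cases h : s' = s
  · cases k <;> simp [Subst.comp, Subst.up, h, Term.subst, ← Term.shift_subst_up]
  · simp [Subst.comp, Subst.up, h, ← Term.shift_subst_up]

theorem Subst.up_var (s : Srt) :
    Subst.up s (fun s k => .var s k : Subst L) = fun s k => .var s k := by
  funext s' k
  by_cases h : s' = s
  · cases k <;> simp [Subst.up, Ren.shift, Term.shift, Term.rename, h]
  · simp [Subst.up, Ren.shift, Term.shift, Term.rename, h]

theorem Subst.ofRen_shift_comp_inst {s : Srt} (a : Term L s) :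
    (Subst.ofRen (Ren.shift s)).comp (Subst.inst a) = fun s k => .var s k := by
  funext s' k
  by_cases h : s' = s
  · subst h
    simp [Subst.comp, Subst.ofRen, Ren.shift, Term.subst, Subst.inst]
  · simp [Subst.comp, Subst.ofRen, Ren.shift, Term.subst, Subst.inst, h]

theorem Term.shift_inst {s : Srt} (a : Term L s) {s' : Srt} (b : Term L s') :
    (b.shift s).subst (Subst.inst a) = b := by
  rw [Term.shift_eq_subst, Term.subst_subst, Subst.ofRen_shift_comp_inst, Term.subst_var]

theorem Subst.inst_comp {s : Srt} (a : Term L s) (θ : Subst L) :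
    (Subst.inst a).comp θ = θ.cons (a.subst θ) := by
  funext s' k
  by_cases h : s' = s
  · subst h
    cases k <;> simp [Subst.comp, Subst.cons, Subst.inst, Subst.up, Term.subst]
    exact (Term.shift_inst (a.subst θ) _).symm
  · have h' := Term.shift_inst (a.subst θ) (θ s' k)
    simp [Subst.comp, Subst.cons, Subst.up, h, h']
    simp [Subst.inst, h, Term.subst]

theorem Form.rename_eq_subst (ρ : Ren) (A : Form L) : A.rename ρ = A.subst (Subst.ofRen ρ) := by
  induction A generalizing ρ <;>
    simp_all [Form.rename, Form.subst, Term.rename_eq_subst, Subst.up_ofRen]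

theorem Form.subst_subst (θ τ : Subst L) (A : Form L) :
    (A.subst θ).subst τ = A.subst (θ.comp τ) := by
  induction A generalizing θ τ <;>
    simp_all [Form.subst, Term.subst_subst, Subst.up_comp]

theorem Form.subst_var (A : Form L) : A.subst (fun s k => .var s k) = A := by
  induction A <;> simp_all [Form.subst, Term.subst_var, Subst.up_var]

theorem Form.shift_eq_subst (s : Srt) (A : Form L) :
    A.shift s = A.subst (Subst.ofRen (Ren.shift s)) :=
  Form.rename_eq_subst _ A

theorem Form.shift_subst_up (s : Srt) (τ : Subst L) (A : Form L) :
    (A.shift s).subst (τ.up s) = (A.subst τ).shift s := by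
  rw [Form.shift_eq_subst, Form.shift_eq_subst, Form.subst_subst, Form.subst_subst,
    Subst.ofRen_shift_comp_up]

theorem Form.shift_inst {s : Srt} (a : Term L s) (A : Form L) : (A.shift s).inst a = A := by
  rw [Form.shift_eq_subst, Form.inst, Form.subst_subst, Subst.ofRen_shift_comp_inst,
    Form.subst_var]

theorem Form.inst_subst {s : Srt} (a : Term L s) (θ : Subst L) (A : Form L) :
    (A.inst a).subst θ = (A.subst (θ.up s)).inst (a.subst θ) := by
  rw [Form.inst, Form.inst, Form.subst_subst, Form.subst_subst, Subst.inst_comp, Subst.cons]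

theorem Term.subst_congr {θ τ : Subst L} {s : Srt} (a : Term L s)
    (h : ∀ s k, a.HasFree s k → θ s k = τ s k) : a.subst θ = a.subst τ := by
  induction a with
  | var s k => exact h s k ⟨rfl, rfl⟩
  | zero => rfl
  | succ a ih => exact congrArg _ (ih h)
  | pred a ih => exact congrArg _ (ih h)
  | fn f b ih => exact congrArg _ (funext fun j => ih j fun s k hk => h s k ⟨j, hk⟩)

theorem Form.subst_congr {θ τ : Subst L} (A : Form L)
    (h : ∀ s k, A.HasFree s k → θ s k = τ s k) : A.subst θ = A.subst τ := by
  induction A generalizing θ τ with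
  | eq a b =>
    exact congrArg₂ Form.eq (a.subst_congr fun s k hk => h s k (.inl hk))
      (b.subst_congr fun s k hk => h s k (.inr hk))
  | nat a => exact congrArg _ (a.subst_congr h)
  | null a => exact congrArg _ (a.subst_congr h)
  | eps n a c =>
    exact congrArg₂ (Form.eps n)
      (funext fun i => (a i).subst_congr fun s k hk => h s k (.inl ⟨i, hk⟩))
      (c.subst_congr fun s k hk => h s k (.inr hk))
  | imp A B ihA ihB =>
    exact congrArg₂ Form.imp (ihA fun s k hk => h s k (.inl hk)) (ihB fun s k hk => h s k (.inr hk))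
  | all s A ih =>
    refine congrArg _ (ih fun s' k hk => ?_)
    by_cases hs : s' = s
    · cases k with
      | zero => simp [Subst.up, hs]
      | succ k =>
        have := h s' k (by simpa [Form.HasFree, hs] using hk)
        simp [Subst.up, hs]
        rw [← hs, this]
    · have := h s' k (by simpa [Form.HasFree, hs] using hk)
      simp [Subst.up, hs, this]

theorem Term.HasFree.rename {ρ : Ren} {s s' : Srt} {k : ℕ} {a : Term L s'} (h : a.HasFree s k) :
    (a.rename ρ).HasFree s (ρ s k) := by
  induction a with
  | var s k => obtain ⟨rfl, rfl⟩ := h; exact ⟨rfl, rfl⟩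
  | zero => exact h
  | succ a ih => exact ih h
  | pred a ih => exact ih h
  | fn f b ih => exact h.imp fun j hj => ih j hj

theorem Form.HasFree.rename {ρ : Ren} {s : Srt} {k : ℕ} {A : Form L} (h : A.HasFree s k) :
    (A.rename ρ).HasFree s (ρ s k) := by
  induction A generalizing ρ k with
  | eq a b => exact h.imp Term.HasFree.rename Term.HasFree.rename
  | nat a => exact Term.HasFree.rename (a := a) h
  | null a => exact Term.HasFree.rename (a := a) h
  | eps n a c => exact h.imp (fun ⟨i, hi⟩ => ⟨i, hi.rename⟩) Term.HasFree.rename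
  | imp A B ihA ihB => exact h.imp ihA ihB
  | all s' A ih =>
    have := ih (ρ := Ren.up s' ρ) (k := if s = s' then k + 1 else k) h
    by_cases hs : s = s'
    · simpa [Form.HasFree, Form.rename, Ren.up, hs] using this
    · simpa [Form.HasFree, Form.rename, Ren.up, hs] using this

end Generic

theorem Scheme.rename_eq_subst (ρ : Ren) (t : Scheme) :
    t.rename ρ = t.subst (Subst.ofRen ρ) := by
  induction t generalizing ρ <;>
    simp_all [Scheme.rename, Scheme.subst, Form.rename_eq_subst, Term.rename_eq_subst,
      Subst.up_ofRen]

theorem Scheme.subst_subst (θ τ : Subst haSig) (t : Scheme) :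
    (t.subst θ).subst τ = t.subst (θ.comp τ) := by
  induction t generalizing θ τ <;>
    simp_all [Scheme.subst, Form.subst_subst, Term.subst_subst, Subst.up_comp]

theorem Scheme.subst_var (t : Scheme) : t.subst (fun s k => .var s k) = t := by
  induction t <;> simp_all [Scheme.subst, Form.subst_var, Term.subst_var, Subst.up_var]

theorem Scheme.shift_eq_subst (s : Srt) (t : Scheme) :
    t.shift s = t.subst (Subst.ofRen (Ren.shift s)) :=
  Scheme.rename_eq_subst _ t

theorem Scheme.shift_subst_up (s : Srt) (τ : Subst haSig) (t : Scheme) :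
    (t.shift s).subst (τ.up s) = (t.subst τ).shift s := by
  rw [Scheme.shift_eq_subst, Scheme.shift_eq_subst, Scheme.subst_subst, Scheme.subst_subst,
    Subst.ofRen_shift_comp_up]

theorem Scheme.shift_inst {s : Srt} (a : Tm s) (t : Scheme) : (t.shift s).inst a = t := by
  rw [Scheme.shift_eq_subst, Scheme.inst, Scheme.subst_subst, Subst.ofRen_shift_comp_inst,
    Scheme.subst_var]

theorem Ctx.shift_image_up (s : Srt) (θ : Subst haSig) (Γ : Ctx) :
    (Ctx.shift s Γ).image (Form.subst (θ.up s)) = Ctx.shift s (Γ.image (Form.subst θ)) := by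
  simp only [Ctx.shift, Finset.image_image]
  congr 1
  funext A
  exact Form.shift_subst_up s θ A

theorem Ctx.shift_image_inst {s : Srt} (a : Tm s) (Γ : Ctx) :
    (Ctx.shift s Γ).image (Form.subst (Subst.inst a)) = Γ := by
  have h : Form.subst (Subst.inst a) ∘ Form.shift s = id := funext (Form.shift_inst a)
  rw [Ctx.shift, Finset.image_image, h, Finset.image_id]

theorem Ctx.shift_union_singleton (s : Srt) (Γ : Ctx) (A : Fm) :
    Ctx.shift s (Γ ∪ {A}) = Ctx.shift s Γ ∪ {A.shift s} := by
  simp [Ctx.shift]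

theorem Ctx.shift_eq_image_subst (s : Srt) (Γ : Ctx) :
    Ctx.shift s Γ = Γ.image (Form.subst (Subst.ofRen (Ren.shift s))) := by
  rw [Ctx.shift]
  congr 1
  exact funext (Form.shift_eq_subst s)

/-! ### Confluence of the rewrite system -/

/-- `Pred(a)`, simplified at the root when `a` is `0` or a successor. -/
def Term.predNf {L : ClassSig} : Term L .iota → Term L .iota
  | .zero => .zero
  | .succ a => a
  | a => .pred a

/-- The normal form of a term for the two rules of `Pred`. -/
def Term.nf : {s : Srt} → Tm s → Tm s
  | _, .var s k => .var s k
  | _, .zero => .zero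
  | _, .succ a => .succ a.nf
  | _, .pred a => a.nf.predNf
  | _, .fn f b => .fn f (fun j => (b j).nf)

/-- The proposition in which all terms are replaced by their normal forms.  Thus `A.nf = B.nf`
says that `A` and `B` have the same shape and congruent terms. -/
def Form.nf : Fm → Fm
  | .eq a b => .eq a.nf b.nf
  | .nat a => .nat a.nf
  | .null a => .null a.nf
  | .eps n a c => .eps n (fun i => (a i).nf) c.nf
  | .imp A B => .imp A.nf B.nf
  | .all s A => .all s A.nf

theorem TermCongr.predNf (a : Tm .iota) : TermCongr (.pred a) a.predNf := by
  cases a with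
  | zero => exact .rule .pred_zero
  | succ a => exact .rule (.pred_succ a)
  | var s k => exact .refl _
  | pred a => exact .refl _

theorem TermCongr.nf {s : Srt} (a : Tm s) : TermCongr a a.nf := by
  induction a with
  | var s k => exact .refl _
  | zero => exact .refl _
  | succ a ih => exact ih.succ
  | pred a ih => exact ih.pred.trans (.predNf _)
  | fn f b ih => exact .fn f ih

theorem TermCongr.nf_eq {s : Srt} {a b : Tm s} (h : TermCongr a b) : a.nf = b.nf := by
  induction h with
  | rule h => cases h <;> rfl
  | refl a => rfl
  | symm _ ih => exact ih.symm
  | trans _ _ ih₁ ih₂ => exact ih₁.trans ih₂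
  | succ _ ih => exact congrArg Term.succ ih
  | pred _ ih => exact congrArg Term.predNf ih
  | fn f _ ih => exact congrArg (Term.fn (L := haSig) f) (funext ih)

theorem TermCongr.of_nf_eq {s : Srt} {a b : Tm s} (h : a.nf = b.nf) : TermCongr a b :=
  (TermCongr.nf a).trans (h ▸ (TermCongr.nf b).symm)

theorem TermCongr.subst {θ : Subst haSig} {s : Srt} {a b : Tm s} (h : TermCongr a b) :
    TermCongr (a.subst θ) (b.subst θ) := by
  induction h with
  | rule h =>
    cases h with
    | pred_zero => exact .rule .pred_zero
    | pred_succ a => exact .rule (.pred_succ _)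
  | refl a => exact .refl _
  | symm _ ih => exact ih.symm
  | trans _ _ ih₁ ih₂ => exact ih₁.trans ih₂
  | succ _ ih => exact ih.succ
  | pred _ ih => exact ih.pred
  | fn f _ ih => exact .fn f ih

theorem Term.nf_shift_congr {s' s : Srt} {a b : Tm s'} (h : a.nf = b.nf) :
    (a.shift s).nf = (b.shift s).nf := by
  rw [Term.shift_eq_subst, Term.shift_eq_subst]
  exact (TermCongr.of_nf_eq h).subst.nf_eq

theorem FormCongr.nf (A : Fm) : FormCongr A A.nf := by
  induction A with
  | eq a b => exact .eq (.nf a) (.nf b)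
  | nat a => exact .nat (.nf a)
  | null a => exact .null (.nf a)
  | eps n a c => exact .eps n (fun i => .nf (a i)) (.nf c)
  | imp A B ihA ihB => exact .imp ihA ihB
  | all s A ih => exact .all s ih

theorem FormCongr.of_nf_eq {A B : Fm} (h : A.nf = B.nf) : FormCongr A B :=
  (FormCongr.nf A).trans (h ▸ (FormCongr.nf B).symm)

theorem Term.nf_subst_congr {θ τ : Subst haSig} {s : Srt} (a : Tm s)
    (h : ∀ s k, a.HasFree s k → (θ s k).nf = (τ s k).nf) : (a.subst θ).nf = (a.subst τ).nf := by
  induction a with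
  | var s k => exact h s k ⟨rfl, rfl⟩
  | zero => rfl
  | succ a ih => exact congrArg Term.succ (ih h)
  | pred a ih => exact congrArg Term.predNf (ih h)
  | fn f b ih =>
    exact congrArg (Term.fn (L := haSig) f) (funext fun j => ih j fun s k hk => h s k ⟨j, hk⟩)

theorem Form.nf_subst_congr {θ τ : Subst haSig} (A : Fm)
    (h : ∀ s k, A.HasFree s k → (θ s k).nf = (τ s k).nf) : (A.subst θ).nf = (A.subst τ).nf := by
  induction A generalizing θ τ with
  | eq a b =>
    exact congrArg₂ Form.eq (a.nf_subst_congr fun s k hk => h s k (.inl hk))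
      (b.nf_subst_congr fun s k hk => h s k (.inr hk))
  | nat a => exact congrArg Form.nat (a.nf_subst_congr h)
  | null a => exact congrArg Form.null (a.nf_subst_congr h)
  | eps n a c =>
    exact congrArg₂ (Form.eps n)
      (funext fun i => (a i).nf_subst_congr fun s k hk => h s k (.inl ⟨i, hk⟩))
      (c.nf_subst_congr fun s k hk => h s k (.inr hk))
  | imp A B ihA ihB =>
    exact congrArg₂ Form.imp (ihA fun s k hk => h s k (.inl hk))
      (ihB fun s k hk => h s k (.inr hk))
  | all s A ih =>
    refine congrArg (Form.all s) (ih fun s' k hk => ?_)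
    by_cases hs : s' = s
    · subst hs
      cases k with
      | zero => simp [Subst.up]
      | succ k =>
        have := h s' k (by simpa [Form.HasFree] using hk)
        simpa [Subst.up] using Term.nf_shift_congr this
    · have := h s' k (by simpa [Form.HasFree, hs] using hk)
      simpa [Subst.up, hs] using Term.nf_shift_congr this

theorem Term.hasFree_of_embed {s s' : Srt} {k : ℕ} (a : Term baseSig s')
    (h : a.embed.HasFree s k) : a.HasFree s k := by
  induction a with
  | var => exact h
  | zero => exact h
  | succ a ih => exact ih h
  | pred a ih => exact ih h
  | fn f => exact Empty.elim f

theorem Form.hasFree_of_embed {s : Srt} {k : ℕ} (A : Form baseSig)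
    (h : A.embed.HasFree s k) : A.HasFree s k := by
  induction A generalizing k with
  | eq a b => exact h.imp a.hasFree_of_embed b.hasFree_of_embed
  | nat a => exact a.hasFree_of_embed h
  | null a => exact a.hasFree_of_embed h
  | eps n a c => exact h.imp (fun ⟨i, hi⟩ => ⟨i, (a i).hasFree_of_embed hi⟩) c.hasFree_of_embed
  | imp A B ihA ihB => exact h.imp ihA ihB
  | all s' A ih => exact ih h

/-- The class symbol at the head of a term. -/
def Term.headSym {L : ClassSig} {s : Srt} : Term L s → Option L.Sym
  | .fn f _ => some f
  | _ => none

/-- The class symbol at the head of the class term of an atom. -/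
def Form.headSym {L : ClassSig} : Form L → Option L.Sym
  | .eps _ _ c => c.headSym
  | _ => none

theorem Form.nf_skolem_inj {f : SkolemSym} {a a' : Fin f.p → Tm .iota}
    {b b' : (j : Fin f.n) → Tm (f.ySort j)}
    (h : (Form.eps f.p a (Term.fn (L := haSig) f b) : Fm).nf =
      (Form.eps f.p a' (Term.fn (L := haSig) f b') : Fm).nf) :
    (∀ i, (a i).nf = (a' i).nf) ∧ ∀ j, (b j).nf = (b' j).nf := by
  simp only [Form.nf, Term.nf] at h
  injection h with _ h₁ h₂
  injection h₂ with _ h₃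
  exact ⟨fun i => congrFun h₁ i, fun j => congrFun h₃ j⟩

/-- The rules have pairwise disjoint left-hand sides, and each is determined by its left-hand
side: two rules that apply to the same atom, up to congruence of terms, yield the same result, up
to congruence of terms. -/
theorem FormRule.coherent {A A' B B' : Fm} (h : FormRule A B) (h' : FormRule A' B')
    (hA : A.nf = A'.nf) : B.nf = B'.nf := by
  cases h with
  | skolem f θ =>
    cases h' with
    | skolem f' θ' =>
      obtain rfl : f = f' := Option.some.inj (congrArg Form.headSym hA)
      obtain ⟨h₁, h₂⟩ := Form.nf_skolem_inj hA
      refine Form.nf_subst_congr _ fun s k hk => ?_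
      rcases f.free s k (Form.hasFree_of_embed _ hk) with ⟨i, hi⟩ | ⟨j, hj⟩
      · cases hi
        exact h₁ i
      · cases hj
        exact h₂ j
    | _ => simp [Form.nf] at hA
  | eq a b =>
    cases h' with
    | eq a' b' =>
      simp only [Form.nf, Form.eq.injEq] at hA
      simp [Form.nf, Form.eps1, Term.nf_shift_congr hA.1, Term.nf_shift_congr hA.2]
    | _ => simp [Form.nf] at hA
  | nat a =>
    cases h' with
    | nat a' =>
      simp only [Form.nf, Form.nat.injEq] at hA
      simp [Form.nf, Form.eps1, Term.nf_shift_congr hA]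
    | _ => simp [Form.nf] at hA
  | null_zero => cases h' <;> simp_all [Form.nf, Term.nf]
  | null_succ a =>
    cases h' with
    | null_succ a' => rfl
    | _ => simp [Form.nf, Term.nf] at hA

/-- Parallel reduction, modulo congruence of terms, with at most one unfolding of each atom. -/
inductive Par : Fm → Fm → Prop
  | of_nf_eq {A B : Fm} : A.nf = B.nf → Par A B
  | unfold {A A' B' B : Fm} : A.nf = A'.nf → FormRule A' B' → B'.nf = B.nf → Par A B
  | imp {A A' B B' : Fm} : Par A A' → Par B B' → Par (.imp A B) (.imp A' B')
  | all (s : Srt) {A A' : Fm} : Par A A' → Par (.all s A) (.all s A')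

theorem Form.nf_eq_imp {A B C : Fm} (h : (Form.imp A B : Fm).nf = C.nf) :
    ∃ A' B', C = .imp A' B' ∧ A.nf = A'.nf ∧ B.nf = B'.nf := by
  cases C <;> simp_all [Form.nf]

theorem Form.nf_eq_all {s : Srt} {A C : Fm} (h : (Form.all s A : Fm).nf = C.nf) :
    ∃ A', C = .all s A' ∧ A.nf = A'.nf := by
  cases C <;> simp_all [Form.nf]

theorem FormRule.lhs_ne_imp {A B C D : Fm} (h : FormRule C D)
    (h' : (Form.imp A B : Fm).nf = C.nf) : False := by
  cases h <;> simp [Form.nf] at h'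

theorem FormRule.lhs_ne_all {s : Srt} {A C D : Fm} (h : FormRule C D)
    (h' : (Form.all s A : Fm).nf = C.nf) : False := by
  cases h <;> simp [Form.nf] at h'

/-- Parallel reduction only depends on its source up to congruence of terms. -/
theorem Par.congr_left {A A' B : Fm} (h : Par A B) (hA : A.nf = A'.nf) : Par A' B := by
  induction h generalizing A' with
  | of_nf_eq h => exact .of_nf_eq (hA.symm.trans h)
  | unfold h r h' => exact .unfold (hA.symm.trans h) r h'
  | imp _ _ ih₁ ih₂ =>
    obtain ⟨_, _, rfl, h₁, h₂⟩ := Form.nf_eq_imp hA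
    exact .imp (ih₁ h₁) (ih₂ h₂)
  | all s _ ih =>
    obtain ⟨_, rfl, h⟩ := Form.nf_eq_all hA
    exact .all s (ih h)

theorem Par.diamond {A B C : Fm} (hB : Par A B) (hC : Par A C) : ∃ D, Par B D ∧ Par C D := by
  induction hB generalizing C with
  | of_nf_eq h => exact ⟨C, hC.congr_left h, .of_nf_eq rfl⟩
  | @unfold A A' B' B h r h' =>
    cases hC with
    | of_nf_eq h₁ => exact ⟨B, .of_nf_eq rfl, .unfold (h₁.symm.trans h) r h'⟩
    | unfold h₁ r₁ h₁' =>
      exact ⟨B, .of_nf_eq rfl,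
        .of_nf_eq (h₁'.symm.trans ((r₁.coherent r (h₁.symm.trans h)).trans h'))⟩
    | imp => exact (r.lhs_ne_imp h).elim
    | all => exact (r.lhs_ne_all h).elim
  | @imp A A' B B' h₁ h₂ ih₁ ih₂ =>
    cases hC with
    | of_nf_eq h => exact ⟨_, .of_nf_eq rfl, (Par.imp h₁ h₂).congr_left h⟩
    | unfold h r _ => exact (r.lhs_ne_imp h).elim
    | imp k₁ k₂ =>
      obtain ⟨D₁, l₁, m₁⟩ := ih₁ k₁
      obtain ⟨D₂, l₂, m₂⟩ := ih₂ k₂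
      exact ⟨_, .imp l₁ l₂, .imp m₁ m₂⟩
  | @all s A A' h ih =>
    cases hC with
    | of_nf_eq h' => exact ⟨_, .of_nf_eq rfl, (Par.all s h).congr_left h'⟩
    | unfold h r _ => exact (r.lhs_ne_all h).elim
    | all _ k =>
      obtain ⟨D, l, m⟩ := ih k
      exact ⟨_, .all s l, .all s m⟩

theorem Par.congr {A B : Fm} (h : Par A B) : FormCongr A B := by
  induction h with
  | of_nf_eq h => exact .of_nf_eq h
  | unfold h r h' => exact (FormCongr.of_nf_eq h).trans ((FormCongr.rule r).trans (.of_nf_eq h'))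
  | imp _ _ ih₁ ih₂ => exact .imp ih₁ ih₂
  | all s _ ih => exact .all s ih

/-- Iterated parallel reduction. -/
def ParRed : Fm → Fm → Prop := Relation.ReflTransGen Par

theorem ParRed.congr {A B : Fm} (h : ParRed A B) : FormCongr A B := by
  induction h with
  | refl => exact .refl _
  | tail _ h ih => exact ih.trans h.congr

theorem ParRed.imp {A A' B B' : Fm} (hA : ParRed A A') (hB : ParRed B B') :
    ParRed (.imp A B) (.imp A' B') :=
  (Relation.ReflTransGen.lift (fun X => Form.imp X B)
      (fun _ _ h => Par.imp h (.of_nf_eq rfl)) _ _ hA).trans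
    (Relation.ReflTransGen.lift (fun X => Form.imp A' X)
      (fun _ _ h => Par.imp (.of_nf_eq rfl) h) _ _ hB)

theorem ParRed.all (s : Srt) {A A' : Fm} (h : ParRed A A') : ParRed (.all s A) (.all s A') :=
  Relation.ReflTransGen.lift (Form.all s) (fun _ _ h => Par.all s h) _ _ h

theorem FormCongr.join {A B : Fm} (h : FormCongr A B) : ∃ C, ParRed A C ∧ ParRed B C := by
  have of_par {A B : Fm} (h : Par A B) : ∃ C, ParRed A C ∧ ParRed B C :=
    ⟨B, .single h, .refl⟩
  induction h with
  | rule r => exact of_par (.unfold rfl r rfl)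
  | refl A => exact ⟨A, .refl, .refl⟩
  | symm _ ih => exact ih.imp fun _ h => h.symm
  | trans _ _ ih₁ ih₂ =>
    have hd (a b c : Fm) (h₁ : Par a b) (h₂ : Par a c) :
        ∃ d, Relation.ReflGen Par b d ∧ Relation.ReflTransGen Par c d :=
      (h₁.diamond h₂).imp fun _ h => ⟨.single h.1, .single h.2⟩
    obtain ⟨D, hA, hB⟩ := ih₁
    obtain ⟨E, hB', hC⟩ := ih₂
    obtain ⟨F, hD, hE⟩ := Relation.church_rosser hd hB hB'
    exact ⟨F, hA.trans hD, hC.trans hE⟩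
  | eq h₁ h₂ => exact of_par (.of_nf_eq (by simp [Form.nf, h₁.nf_eq, h₂.nf_eq]))
  | nat h => exact of_par (.of_nf_eq (by simp [Form.nf, h.nf_eq]))
  | null h => exact of_par (.of_nf_eq (by simp [Form.nf, h.nf_eq]))
  | eps n h₁ h₂ =>
    exact of_par (.of_nf_eq (by simp [Form.nf, fun i => (h₁ i).nf_eq, h₂.nf_eq]))
  | imp _ _ ih₁ ih₂ =>
    obtain ⟨C₁, h₁, k₁⟩ := ih₁
    obtain ⟨C₂, h₂, k₂⟩ := ih₂
    exact ⟨_, h₁.imp h₂, k₁.imp k₂⟩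
  | all s _ ih =>
    obtain ⟨C, h, k⟩ := ih
    exact ⟨_, h.all s, k.all s⟩

theorem ParRed.imp_inv {A B C : Fm} (h : ParRed (.imp A B) C) :
    ∃ A' B', C = .imp A' B' ∧ ParRed A A' ∧ ParRed B B' := by
  induction h with
  | refl => exact ⟨A, B, rfl, .refl, .refl⟩
  | tail _ h ih =>
    obtain ⟨A', B', rfl, hA, hB⟩ := ih
    cases h with
    | of_nf_eq h =>
      obtain ⟨_, _, rfl, h₁, h₂⟩ := Form.nf_eq_imp h
      exact ⟨_, _, rfl, hA.tail (.of_nf_eq h₁), hB.tail (.of_nf_eq h₂)⟩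
    | unfold h r _ => exact (r.lhs_ne_imp h).elim
    | imp h₁ h₂ => exact ⟨_, _, rfl, hA.tail h₁, hB.tail h₂⟩

theorem ParRed.all_inv {s : Srt} {A C : Fm} (h : ParRed (.all s A) C) :
    ∃ A', C = .all s A' ∧ ParRed A A' := by
  induction h with
  | refl => exact ⟨A, rfl, .refl⟩
  | tail _ h ih =>
    obtain ⟨A', rfl, hA⟩ := ih
    cases h with
    | of_nf_eq h =>
      obtain ⟨_, rfl, h₁⟩ := Form.nf_eq_all h
      exact ⟨_, rfl, hA.tail (.of_nf_eq h₁)⟩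
    | unfold h r _ => exact (r.lhs_ne_all h).elim
    | all _ h => exact ⟨_, rfl, hA.tail h⟩

theorem Form.nf_eq_eps0_var {k : ℕ} {C : Fm}
    (h : (Form.eps0 (.var _ k) : Fm).nf = C.nf) : C = .eps0 (.var _ k) := by
  have hvar : ∀ {s : Srt} (c : Tm s), c.nf = .var s k → s ≠ .iota → c = .var s k := by
    intro s c hc hs
    cases c <;> simp_all [Term.nf]
  cases C with
  | eps n a c =>
    simp only [Form.nf, Form.eps0] at h
    injection h with h₀ h₁ h₂
    subst h₀
    rw [hvar c (eq_of_heq h₂).symm (by simp), Form.eps0]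
    congr 1
    exact funext fun i => i.elim0
  | _ => simp [Form.nf, Form.eps0] at h

/-- No rule applies to `ε_0(c)` for a variable `c`. -/
theorem FormRule.lhs_ne_eps0_var {k : ℕ} {C D : Fm} (h : FormRule C D)
    (h' : (Form.eps0 (.var _ k) : Fm).nf = C.nf) : False := by
  have hC := congrArg Form.headSym (Form.nf_eq_eps0_var h')
  cases h with
  | skolem f θ => simp [Form.eps0, Form.headSym, Term.headSym] at hC
  | _ => simp [Form.eps0, Form.nf] at h'

theorem ParRed.eps0_var_inv {k : ℕ} {C : Fm} (h : ParRed (.eps0 (.var _ k)) C) :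
    C = .eps0 (.var _ k) := by
  induction h with
  | refl => rfl
  | tail _ h ih =>
    subst ih
    cases h with
    | of_nf_eq h => exact Form.nf_eq_eps0_var h
    | unfold h r _ => exact (r.lhs_ne_eps0_var h).elim

theorem FormCongr.imp_inj {A B A' B' : Fm} (h : FormCongr (.imp A B) (.imp A' B')) :
    FormCongr A A' ∧ FormCongr B B' := by
  obtain ⟨C, h₁, h₂⟩ := h.join
  obtain ⟨D, E, rfl, hD, hE⟩ := h₁.imp_inv
  obtain ⟨D', E', heq, hD', hE'⟩ := h₂.imp_inv
  cases heq
  exact ⟨hD.congr.trans hD'.congr.symm, hE.congr.trans hE'.congr.symm⟩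

theorem FormCongr.all_inj {s s' : Srt} {A A' : Fm} (h : FormCongr (.all s A) (.all s' A')) :
    s = s' ∧ FormCongr A A' := by
  obtain ⟨C, h₁, h₂⟩ := h.join
  obtain ⟨D, rfl, hD⟩ := h₁.all_inv
  obtain ⟨D', heq, hD'⟩ := h₂.all_inv
  cases heq
  exact ⟨rfl, hD.congr.trans hD'.congr.symm⟩

theorem FormCongr.not_imp_all {s : Srt} {A B C : Fm} : ¬ FormCongr (.imp A B) (.all s C) := by
  intro h
  obtain ⟨D, h₁, h₂⟩ := h.join
  obtain ⟨_, _, rfl, _⟩ := h₁.imp_inv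
  obtain ⟨_, heq, _⟩ := h₂.all_inv
  cases heq

theorem FormCongr.not_imp_eps0_var {A B : Fm} {k : ℕ} :
    ¬ FormCongr (.imp A B) (.eps0 (.var _ k)) := by
  intro h
  obtain ⟨D, h₁, h₂⟩ := h.join
  obtain ⟨_, _, rfl, _⟩ := h₁.imp_inv
  cases h₂.eps0_var_inv

theorem FormCongr.not_all_eps0_var {s : Srt} {A : Fm} {k : ℕ} :
    ¬ FormCongr (.all s A) (.eps0 (.var _ k)) := by
  intro h
  obtain ⟨D, h₁, h₂⟩ := h.join
  obtain ⟨_, rfl, _⟩ := h₁.all_inv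
  cases h₂.eps0_var_inv

/-! ### Typing and subject reduction -/

theorem Form.eps0_subst (θ : Subst haSig) (c : Tm (.kappa 0)) :
    (Form.eps0 c).subst θ = .eps0 (c.subst θ) :=
  congrArg₂ (Form.eps 0) (funext fun i => i.elim0) rfl

theorem FormRule.subst {A B : Fm} (h : FormRule A B) (θ : Subst haSig) :
    FormRule (A.subst θ) (B.subst θ) := by
  cases h with
  | skolem f τ =>
    rw [Form.subst_subst]
    exact .skolem f (τ.comp θ)
  | eq a b =>
    have := FormRule.eq (a.subst θ) (b.subst θ)
    rw [← Term.shift_subst_up, ← Term.shift_subst_up] at this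
    exact this
  | nat a =>
    have := FormRule.nat (a.subst θ)
    rw [← Term.shift_subst_up] at this
    exact this
  | null_zero =>
    have h : Form.top.subst θ = .top := by
      simp [Form.top, Form.subst, Form.eps0_subst, Term.subst, Subst.up]
    change FormRule (.null .zero) (Form.top.subst θ)
    exact h.symm ▸ .null_zero
  | null_succ a =>
    have h : Form.bot.subst θ = .bot := by
      simp [Form.bot, Form.subst, Form.eps0_subst, Term.subst, Subst.up]
    change FormRule (.null (.succ (a.subst θ))) (Form.bot.subst θ)
    exact h.symm ▸ .null_succ _

theorem FormCongr.subst {A B : Fm} (h : FormCongr A B) (θ : Subst haSig) :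
    FormCongr (A.subst θ) (B.subst θ) := by
  induction h generalizing θ with
  | rule r => exact .rule (r.subst θ)
  | refl A => exact .refl _
  | symm _ ih => exact (ih θ).symm
  | trans _ _ ih₁ ih₂ => exact (ih₁ θ).trans (ih₂ θ)
  | eq h₁ h₂ => exact .eq h₁.subst h₂.subst
  | nat h => exact .nat h.subst
  | null h => exact .null h.subst
  | eps n h₁ h₂ => exact .eps n (fun i => (h₁ i).subst) h₂.subst
  | imp _ _ ih₁ ih₂ => exact .imp (ih₁ θ) (ih₂ θ)
  | all s _ ih => exact .all s (ih _)

theorem HasType.weaken {Γ Δ : Ctx} {t : Scheme} {A : Fm} (h : HasType Γ t A) (hΓ : Γ ⊆ Δ) :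
    HasType Δ t A := by
  induction h generalizing Δ with
  | ax h => exact .ax (hΓ h)
  | lam _ ih => exact .lam (ih (Finset.union_subset_union_left hΓ))
  | app _ _ ih₁ ih₂ => exact .app (ih₁ hΓ) (ih₂ hΓ)
  | tlam _ ih => exact .tlam (ih (Finset.image_subset_image hΓ))
  | tapp a _ ih => exact .tapp a (ih hΓ)
  | conv _ hc ih => exact .conv (ih hΓ) hc

theorem HasType.subst {Γ : Ctx} {t : Scheme} {A : Fm} (h : HasType Γ t A) (θ : Subst haSig) :
    HasType (Γ.image (Form.subst θ)) (t.subst θ) (A.subst θ) := by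
  induction h generalizing θ with
  | ax h => exact .ax (Finset.mem_image_of_mem _ h)
  | lam _ ih =>
    refine .lam ?_
    have := ih θ
    rwa [Finset.image_union, Finset.image_singleton] at this
  | app _ _ ih₁ ih₂ => exact .app (ih₁ θ) (ih₂ θ)
  | @tlam _ s _ _ _ ih =>
    refine .tlam ?_
    have := ih (θ.up s)
    rwa [Ctx.shift_image_up] at this
  | tapp a _ ih =>
    rw [Form.inst_subst]
    exact .tapp _ (ih θ)
  | conv _ hc ih => exact .conv (ih θ) (hc.subst θ)

theorem HasType.shift {Γ : Ctx} {t : Scheme} {A : Fm} (h : HasType Γ t A) (s : Srt) :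
    HasType (Ctx.shift s Γ) (t.shift s) (A.shift s) := by
  rw [Ctx.shift_eq_image_subst, Scheme.shift_eq_subst, Form.shift_eq_subst]
  exact h.subst _

theorem HasType.inst {Γ : Ctx} {s : Srt} {t : Scheme} {A : Fm} (h : HasType (Ctx.shift s Γ) t A)
    (a : Tm s) : HasType Γ (t.inst a) (A.inst a) := by
  have := h.subst (Subst.inst a)
  rwa [Ctx.shift_image_inst] at this

theorem HasType.var_inv {Γ : Ctx} {A C : Fm} (h : HasType Γ (.var A) C) :
    A ∈ Γ ∧ FormCongr A C := by
  generalize ht : Scheme.var A = t at h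
  induction h with
  | ax h => cases ht; exact ⟨h, .refl _⟩
  | conv _ hc ih => exact (ih ht).imp_right fun h => h.trans hc
  | _ => cases ht

theorem HasType.lam_inv {Γ : Ctx} {A C : Fm} {t : Scheme} (h : HasType Γ (.lam A t) C) :
    ∃ B, HasType (Γ ∪ {A}) t B ∧ FormCongr (.imp A B) C := by
  generalize ht : Scheme.lam A t = t' at h
  induction h with
  | lam h _ => cases ht; exact ⟨_, h, .refl _⟩
  | conv _ hc ih => exact (ih ht).imp fun B h => ⟨h.1, h.2.trans hc⟩
  | _ => cases ht

theorem HasType.app_inv {Γ : Ctx} {C : Fm} {t u : Scheme} (h : HasType Γ (.app t u) C) :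
    ∃ A B, HasType Γ t (.imp A B) ∧ HasType Γ u A ∧ FormCongr B C := by
  generalize ht : Scheme.app t u = t' at h
  induction h with
  | app h₁ h₂ _ _ => cases ht; exact ⟨_, _, h₁, h₂, .refl _⟩
  | conv _ hc ih =>
    obtain ⟨A, B, h₁, h₂, h₃⟩ := ih ht
    exact ⟨A, B, h₁, h₂, h₃.trans hc⟩
  | _ => cases ht

theorem HasType.tlam_inv {Γ : Ctx} {s : Srt} {C : Fm} {t : Scheme}
    (h : HasType Γ (.tlam s t) C) :
    ∃ A, HasType (Ctx.shift s Γ) t A ∧ FormCongr (.all s A) C := by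
  generalize ht : Scheme.tlam s t = t' at h
  induction h with
  | tlam h _ => cases ht; exact ⟨_, h, .refl _⟩
  | conv _ hc ih => exact (ih ht).imp fun B h => ⟨h.1, h.2.trans hc⟩
  | _ => cases ht

theorem HasType.tapp_inv {Γ : Ctx} {s : Srt} {C : Fm} {t : Scheme} {a : Tm s}
    (h : HasType Γ (.tapp t a) C) :
    ∃ A, HasType Γ t (.all s A) ∧ FormCongr (A.inst a) C := by
  generalize ht : Scheme.tapp t a = t' at h
  induction h with
  | tapp a h _ => cases ht; exact ⟨_, h, .refl _⟩
  | conv _ hc ih => exact (ih ht).imp fun B h => ⟨h.1, h.2.trans hc⟩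
  | _ => cases ht

/-- Whichever optional replacements are made, replacing canonical variables preserves types. -/
theorem HasType.gsubst {Γ Δ : Ctx} {t u v : Scheme} {A B : Fm} (ht : HasType Δ t B)
    (hΔ : Δ ⊆ Γ ∪ {A}) (hu : HasType Γ u A) (hv : v ∈ t.gsubst u A Γ) : HasType Γ v B := by
  induction ht generalizing Γ u v A with
  | @ax Δ C h =>
    rcases hv with ⟨rfl, rfl⟩ | ⟨hC, rfl⟩
    · exact hu
    · refine .ax ?_
      rcases Finset.mem_union.1 (hΔ h) with h | h
      · exact h
      · rw [Finset.mem_singleton] at h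
        rcases hC with hC | hC
        · exact (hC h).elim
        · exact h ▸ hC
  | @lam Δ C _ t _ ih =>
    obtain ⟨v, hv, rfl⟩ := hv
    refine .lam (ih ?_ (hu.weaken Finset.subset_union_left) hv)
    rw [Finset.union_right_comm]
    exact Finset.union_subset_union_left hΔ
  | app _ _ ih₁ ih₂ =>
    obtain ⟨v₁, h₁, v₂, h₂, rfl⟩ := hv
    exact .app (ih₁ hΔ hu h₁) (ih₂ hΔ hu h₂)
  | @tlam Δ s _ t _ ih =>
    obtain ⟨v, hv, rfl⟩ := hv
    refine .tlam (ih ?_ (hu.shift s) hv)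
    rw [← Ctx.shift_union_singleton]
    exact Finset.image_subset_image hΔ
  | tapp a _ ih =>
    obtain ⟨v, hv, rfl⟩ := hv
    exact .tapp a (ih hΔ hu hv)
  | conv _ hc ih => exact .conv (ih hΔ hu hv) hc

theorem BetaStep.hasType {Γ : Ctx} {t v : Scheme} {C : Fm} (h : BetaStep Γ t v)
    (ht : HasType Γ t C) : HasType Γ v C := by
  induction h generalizing C with
  | beta hv =>
    obtain ⟨A', B, h₁, h₂, h₃⟩ := ht.app_inv
    obtain ⟨B', h₄, h₅⟩ := h₁.lam_inv
    obtain ⟨hA, hB⟩ := h₅.imp_inj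
    exact (h₄.gsubst subset_rfl (h₂.conv hA.symm) hv).conv (hB.trans h₃)
  | tbeta a =>
    obtain ⟨A, h₁, h₂⟩ := ht.tapp_inv
    obtain ⟨A', h₃, h₄⟩ := h₁.tlam_inv
    exact (h₃.inst a).conv ((h₄.all_inj.2.subst _).trans h₂)
  | appL _ ih =>
    obtain ⟨A, B, h₁, h₂, h₃⟩ := ht.app_inv
    exact (HasType.app (ih h₁) h₂).conv h₃
  | appR _ ih =>
    obtain ⟨A, B, h₁, h₂, h₃⟩ := ht.app_inv
    exact (HasType.app h₁ (ih h₂)).conv h₃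
  | lam _ ih =>
    obtain ⟨B, h₁, h₂⟩ := ht.lam_inv
    exact (HasType.lam (ih h₁)).conv h₂
  | tlam _ ih =>
    obtain ⟨B, h₁, h₂⟩ := ht.tlam_inv
    exact (HasType.tlam (ih h₁)).conv h₂
  | tapp a _ ih =>
    obtain ⟨B, h₁, h₂⟩ := ht.tapp_inv
    exact (HasType.tapp a (ih h₁)).conv h₂

theorem BetaRed.hasType {Γ : Ctx} {t v : Scheme} {C : Fm} (h : BetaRed Γ t v)
    (ht : HasType Γ t C) : HasType Γ v C := by
  induction h with
  | refl => exact ht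
  | tail _ h ih => exact h.hasType ih

theorem Scheme.minSubst_mem_gsubst (t w : Scheme) (A : Fm) (Γ : Ctx) :
    t.minSubst w A Γ ∈ t.gsubst w A Γ := by
  induction t generalizing w A Γ with
  | var B =>
    by_cases h : B = A ∧ A ∉ Γ
    · exact .inl ⟨h.1, if_pos h⟩
    · exact .inr ⟨by tauto, if_neg h⟩
  | lam B t ih => exact ⟨_, ih _ _ _, rfl⟩
  | app t u iht ihu => exact ⟨_, iht _ _ _, _, ihu _ _ _, rfl⟩
  | tlam s t ih => exact ⟨_, ih _ _ _, rfl⟩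
  | tapp t a ih => exact ⟨_, ih _ _ _, rfl⟩

theorem WeakStep.betaStep {Γ : Ctx} {t v : Scheme} (h : WeakStep Γ t v) : BetaStep Γ t v := by
  induction h with
  | beta => exact .beta (Scheme.minSubst_mem_gsubst _ _ _ _)
  | tbeta a => exact .tbeta a
  | app _ ih => exact .appL ih
  | tapp a _ ih => exact .tapp a ih

theorem WeakRed.betaRed {Γ : Ctx} {t v : Scheme} (h : WeakRed Γ t v) : BetaRed Γ t v :=
  Relation.ReflTransGen.mono (fun _ _ => WeakStep.betaStep) _ _ h

/-- In the context `∀x (A ⇒ ε_0(c))`, a typed scheme that is irreducible for weak minimal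
reduction is an abstraction or an initial part of `(g a u)`. -/
theorem HasType.weak_normal_cases {s : Srt} {A : Fm} {k : ℕ} {G : Fm}
    (hG : G = Form.allImp s A (.eps0 (.var _ k))) {n : Scheme} {C : Fm}
    (h : HasType {G} n C) (hn : ∀ n', ¬ WeakStep {G} n n') :
    (∃ B t, n = .lam B t) ∨ (∃ s t, n = .tlam s t) ∨
    n = .var G ∨ (∃ a : Tm s, n = .tapp (.var G) a) ∨
    ∃ (a : Tm s) (u : Scheme), n = .app (.tapp (.var G) a) u := by
  have htapp {a : Tm s} {C : Fm} (h : HasType {G} (.tapp (.var G) a) C) :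
      FormCongr (.imp (A.inst a) (.eps0 (.var _ k))) C := by
    obtain ⟨B, h₁, h₂⟩ := h.tapp_inv
    have h₃ := h₁.var_inv.2
    rw [hG, Form.allImp] at h₃
    have h₄ := (h₃.all_inj.2.subst (Subst.inst a)).trans h₂
    have h₅ : Form.subst (Subst.inst a) ((Form.eps0 (.var _ k)).shift s) =
      .eps0 (.var _ k) := Form.shift_inst a _
    rwa [Form.subst, h₅] at h₄
  induction n generalizing C with
  | var B => exact .inr (.inr (.inl (by rw [Finset.mem_singleton.1 h.var_inv.1])))
  | lam B t => exact .inl ⟨B, t, rfl⟩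
  | tlam s t => exact .inr (.inl ⟨s, t, rfl⟩)
  | app t u iht _ =>
    obtain ⟨D, E, h₁, h₂, h₃⟩ := h.app_inv
    rcases iht h₁ fun n' h' => hn _ h'.app with
      ⟨B, t, rfl⟩ | ⟨s, t, rfl⟩ | rfl | ⟨a, rfl⟩ | ⟨a, v, rfl⟩
    · exact (hn _ .beta).elim
    · obtain ⟨_, _, h⟩ := h₁.tlam_inv
      exact (FormCongr.not_imp_all h.symm).elim
    · have := h₁.var_inv.2
      rw [hG] at this
      exact (FormCongr.not_imp_all this.symm).elim
    · exact .inr (.inr (.inr (.inr ⟨a, u, rfl⟩)))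
    · obtain ⟨_, _, k₁, _, k₂⟩ := h₁.app_inv
      exact (FormCongr.not_imp_eps0_var (((htapp k₁).imp_inj.2.trans k₂).symm)).elim
  | @tapp s' t b ih =>
    obtain ⟨D, h₁, h₂⟩ := h.tapp_inv
    rcases ih h₁ fun n' h' => hn _ (h'.tapp b) with
      ⟨B, t, rfl⟩ | ⟨s, t, rfl⟩ | rfl | ⟨a, rfl⟩ | ⟨a, v, rfl⟩
    · obtain ⟨_, _, h⟩ := h₁.lam_inv
      exact (FormCongr.not_imp_all h).elim
    · obtain ⟨_, _, h⟩ := h₁.tlam_inv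
      obtain ⟨rfl, _⟩ := h.all_inj
      exact (hn _ (.tbeta b)).elim
    · have := h₁.var_inv.2
      rw [hG] at this
      obtain ⟨rfl, _⟩ := this.all_inj
      exact .inr (.inr (.inr (.inl ⟨b, rfl⟩)))
    · exact (FormCongr.not_imp_all (htapp h₁)).elim
    · obtain ⟨_, _, k₁, _, k₂⟩ := h₁.app_inv
      exact (FormCongr.not_all_eps0_var (((htapp k₁).imp_inj.2.trans k₂).symm)).elim

theorem HasType.weak_normal_eps0 {s : Srt} {A : Fm} {k : ℕ} {G : Fm}
    (hG : G = Form.allImp s A (.eps0 (.var _ k))) {n : Scheme}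
    (h : HasType {G} n (.eps0 (.var _ k))) (hn : ∀ n', ¬ WeakStep {G} n n') :
    ∃ (a : Tm s) (u : Scheme), n = .app (.tapp (.var G) a) u := by
  rcases h.weak_normal_cases hG hn with
    ⟨B, t, rfl⟩ | ⟨s, t, rfl⟩ | rfl | ⟨a, rfl⟩ | h'
  · obtain ⟨_, _, h⟩ := h.lam_inv
    exact (FormCongr.not_imp_eps0_var h).elim
  · obtain ⟨_, _, h⟩ := h.tlam_inv
    exact (FormCongr.not_all_eps0_var h).elim
  · have := h.var_inv.2
    nth_rw 1 [hG] at this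
    exact (FormCongr.not_all_eps0_var this).elim
  · obtain ⟨_, h₁, h₂⟩ := h.tapp_inv
    have h₃ := h₁.var_inv.2
    nth_rw 1 [hG] at h₃
    exact (FormCongr.not_imp_eps0_var ((h₃.all_inj.2.subst _).trans h₂)).elim
  · exact h'

/-- Types of the parts of `(g a u)`. -/
theorem HasType.witness {s : Srt} {A : Fm} {k : ℕ} {G C : Fm} {Γ : Ctx}
    (hG : G = Form.allImp s A (.eps0 (.var _ k))) {a : Tm s} {u : Scheme}
    (h : HasType Γ (.app (.tapp (.var G) a) u) C) : HasType Γ u (A.inst a) := by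
  obtain ⟨D, E, h₁, h₂, _⟩ := h.app_inv
  obtain ⟨B, h₃, h₄⟩ := h₁.tapp_inv
  have h₅ := h₃.var_inv.2
  rw [hG] at h₅
  exact h₂.conv ((h₅.all_inj.2.subst (Subst.inst a)).trans h₄).imp_inj.1.symm

/-! ### Scoped schemes and sets closed under expansion -/

/-- Every canonical variable of the scheme belongs to the context or to an enclosing `λ`. -/
def Scheme.Scoped : Scheme → Ctx → Prop
  | .var A, Γ => A ∈ Γ
  | .lam A t, Γ => t.Scoped (Γ ∪ {A})
  | .app t u, Γ => t.Scoped Γ ∧ u.Scoped Γ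
  | .tlam s t, Γ => t.Scoped (Ctx.shift s Γ)
  | .tapp t _, Γ => t.Scoped Γ

theorem Scheme.Scoped.mono {t : Scheme} {Γ Δ : Ctx} (h : t.Scoped Γ) (hΓ : Γ ⊆ Δ) :
    t.Scoped Δ := by
  induction t generalizing Γ Δ with
  | var A => exact hΓ h
  | lam A t ih => exact ih h (Finset.union_subset_union_left hΓ)
  | app t u iht ihu => exact ⟨iht h.1 hΓ, ihu h.2 hΓ⟩
  | tlam s t ih => exact ih h (Finset.image_subset_image hΓ)
  | tapp t a ih => exact ih h hΓ

theorem Scheme.Scoped.subst {t : Scheme} {Γ : Ctx} (h : t.Scoped Γ) (θ : Subst haSig) :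
    (t.subst θ).Scoped (Γ.image (Form.subst θ)) := by
  induction t generalizing Γ θ with
  | var A => exact Finset.mem_image_of_mem _ h
  | lam A t ih =>
    have := ih h θ
    rwa [Finset.image_union, Finset.image_singleton] at this
  | app t u iht ihu => exact ⟨iht h.1 θ, ihu h.2 θ⟩
  | tlam s t ih =>
    have := ih h (θ.up s)
    rwa [Ctx.shift_image_up] at this
  | tapp t a ih => exact ih h θ

theorem Scheme.Scoped.shift {t : Scheme} {Γ : Ctx} (h : t.Scoped Γ) (s : Srt) :
    (t.shift s).Scoped (Ctx.shift s Γ) := by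
  rw [Ctx.shift_eq_image_subst, Scheme.shift_eq_subst]
  exact h.subst _

theorem HasType.scoped {Γ : Ctx} {t : Scheme} {A : Fm} (h : HasType Γ t A) : t.Scoped Γ := by
  induction h with
  | ax h => exact h
  | lam _ ih => exact ih
  | app _ _ ih₁ ih₂ => exact ⟨ih₁, ih₂⟩
  | tlam _ ih => exact ih
  | tapp a _ ih => exact ih
  | conv _ _ ih => exact ih

/-- In a scoped scheme no replacement is forced. -/
theorem Scheme.Scoped.mem_gsubst_self {t : Scheme} {Γ : Ctx} (h : t.Scoped Γ) (u : Scheme)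
    (A : Fm) : t ∈ t.gsubst u A Γ := by
  induction t generalizing Γ u A with
  | var B =>
    refine .inr ⟨?_, rfl⟩
    by_cases hB : B = A
    · exact .inr (hB ▸ h)
    · exact .inl hB
  | lam B t ih => exact ⟨t, ih h _ _, rfl⟩
  | app t v iht ihv => exact ⟨t, iht h.1 _ _, v, ihv h.2 _ _, rfl⟩
  | tlam s t ih => exact ⟨t, ih h _ _, rfl⟩
  | tapp t a ih => exact ⟨t, ih h _ _, rfl⟩

/-- A set of schemes scoped in `Γ` that is closed under β-expansion. -/
structure Cand (Γ : Ctx) where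
  carrier : Set Scheme
  isScoped : ∀ t ∈ carrier, t.Scoped Γ
  expand : ∀ t t', t.Scoped Γ → BetaStep Γ t t' → t' ∈ carrier → t ∈ carrier

namespace Cand

variable {Γ : Ctx}

instance : SetLike (Cand Γ) Scheme where
  coe := carrier
  coe_injective X Y h := by cases X; cases Y; cases h; rfl

/-- The schemes that map `X` to `Y`. -/
def imp (X Y : Cand Γ) : Cand Γ where
  carrier := {t | t.Scoped Γ ∧ ∀ u ∈ X, .app t u ∈ Y}
  isScoped _ h := h.1
  expand _ _ ht hs h := ⟨ht, fun u hu =>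
    Y.expand (.app _ u) _ ⟨ht, X.isScoped u hu⟩ (.appL hs) (h.2 u hu)⟩

/-- The schemes whose applications to terms of sort `s` are in all the `F d`.  The term and the
index `d` are independent. -/
def all {D : Type} (s : Srt) (F : D → Cand Γ) : Cand Γ where
  carrier := {t | t.Scoped Γ ∧ ∀ (a : Tm s) (d : D), .tapp t a ∈ F d}
  isScoped _ h := h.1
  expand _ _ ht hs h := ⟨ht, fun a d => (F d).expand _ _ ht (.tapp a hs) (h.2 a d)⟩

/-- The intersection of a family. -/
def inter (S : Set (Cand Γ)) : Cand Γ where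
  carrier := {t | t.Scoped Γ ∧ ∀ X ∈ S, t ∈ X}
  isScoped _ h := h.1
  expand _ _ ht hs h := ⟨ht, fun X hX => X.expand _ _ ht hs (h.2 X hX)⟩

theorem inter_singleton (X : Cand Γ) : inter {X} = X := by
  refine SetLike.ext fun t => ⟨fun h => ?_, fun h => ?_⟩
  · exact h.2 X rfl
  · exact ⟨X.isScoped t h, fun _ hY => hY ▸ h⟩

/-- The right-hand side of the rule for `N`, as an operator on the interpretation of `N`. -/
def natOp (F : ℕ → Cand Γ) (n : ℕ) : Cand Γ :=
  all (.kappa 1) fun d : (Fin 1 → ℕ) → Cand Γ =>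
    imp (d fun _ => 0)
      (imp (all .iota fun m : ℕ => imp (F m) (imp (d fun _ => m) (d fun _ => m + 1)))
        (d fun _ => n))

theorem imp_mono {X X' Y Y' : Cand Γ} (hX : ∀ t ∈ X', t ∈ X) (hY : ∀ t ∈ Y, t ∈ Y') (t : Scheme)
    (h : t ∈ imp X Y) : t ∈ imp X' Y' :=
  ⟨h.1, fun u hu => hY _ (h.2 u (hX u hu))⟩

theorem all_mono {D : Type} {s : Srt} {F F' : D → Cand Γ} (hF : ∀ d, ∀ t ∈ F d, t ∈ F' d)
    (t : Scheme) (h : t ∈ all s F) : t ∈ all s F' :=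
  ⟨h.1, fun a d => hF d _ (h.2 a d)⟩

theorem natOp_mono {F F' : ℕ → Cand Γ} (hF : ∀ n, ∀ t ∈ F n, t ∈ F' n) (n : ℕ) :
    ∀ t ∈ natOp F n, t ∈ natOp F' n :=
  all_mono fun _ => imp_mono (fun _ => id)
    (imp_mono (all_mono fun m => imp_mono (hF m) fun _ => id) fun _ => id)

/-- The interpretation of `N`: the least fixed point of `natOp`. -/
def natSem (n : ℕ) : Cand Γ :=
  inter {X | ∃ F : ℕ → Cand Γ, (∀ m, ∀ t ∈ natOp F m, t ∈ F m) ∧ X = F n}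

/-- The interpretation of `Null`. -/
def nullSem : ℕ → Cand Γ
  | 0 => all (.kappa 0) fun d : (Fin 0 → ℕ) → Cand Γ =>
      imp (d fun i => i.elim0) (d fun i => i.elim0)
  | _ + 1 => all (.kappa 0) fun d : (Fin 0 → ℕ) → Cand Γ => d fun i => i.elim0

theorem natOp_natSem (n : ℕ) : natOp (natSem (Γ := Γ)) n = natSem n := by
  have le {F : ℕ → Cand Γ} (hF : ∀ m, ∀ t ∈ natOp F m, t ∈ F m) (m : ℕ) (t : Scheme)
      (ht : t ∈ natSem (Γ := Γ) m) : t ∈ F m :=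
    ht.2 _ ⟨F, hF, rfl⟩
  have h₁ (m : ℕ) : ∀ t ∈ natOp (natSem (Γ := Γ)) m, t ∈ natSem (Γ := Γ) m := by
    rintro t ht
    refine ⟨(natOp _ m).isScoped t ht, ?_⟩
    rintro _ ⟨F, hF, rfl⟩
    exact hF m t (natOp_mono (le hF) m t ht)
  refine SetLike.ext fun t => ⟨h₁ n t, fun ht => ?_⟩
  exact le (F := natOp natSem) (natOp_mono h₁) n t ht

end Cand

/-! ### The model of sets of schemes -/

/-- The domains of the model: numbers, and predicates on numbers with values in `Cand Γ`. -/
abbrev Dom (Γ : Ctx) : Srt → Type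
  | .iota => ℕ
  | .kappa n => (Fin n → ℕ) → Cand Γ

/-- Assignments of values to the variables. -/
abbrev Val (Γ : Ctx) : Type := (s : Srt) → ℕ → Dom Γ s

/-- The assignment `φ` extended by `d` for a new variable `0` of sort `s`. -/
def Val.cons {Γ : Ctx} {s : Srt} (φ : Val Γ) (d : Dom Γ s) : Val Γ := fun s' k =>
  if h : s' = s then (match k with
    | 0 => h ▸ d
    | k + 1 => φ s' k)
  else φ s' k

/-- Interpretations of the class symbols of a signature. -/
abbrev SymSem (Γ : Ctx) (L : ClassSig) : Type :=
  (f : L.Sym) → ((j : Fin (L.len f)) → Dom Γ (L.par f j)) → Dom Γ (.kappa (L.cls f))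

section Generic

variable {Γ : Ctx} {L : ClassSig} (I : SymSem Γ L)

/-- The value of a term. -/
def Term.sem (φ : Val Γ) : {s : Srt} → Term L s → Dom Γ s
  | _, .var s k => φ s k
  | _, .zero => (0 : ℕ)
  | _, .succ a => Nat.succ (a.sem φ)
  | _, .pred a => Nat.pred (a.sem φ)
  | _, .fn f b => I f (fun j => (b j).sem φ)

/-- The value of a proposition.  Atoms with a rewrite rule have the value of the right-hand side
of the rule. -/
def Form.sem : Val Γ → Form L → Cand Γ
  | φ, .eq a b => .all (.kappa 1) fun d : (Fin 1 → ℕ) → Cand Γ =>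
      .imp (d fun _ => a.sem I φ) (d fun _ => b.sem I φ)
  | φ, .nat a => Cand.natSem (a.sem I φ)
  | φ, .null a => Cand.nullSem (a.sem I φ)
  | φ, .eps n a c => (c.sem I φ : (Fin n → ℕ) → Cand Γ) fun i => (a i).sem I φ
  | φ, .imp A B => .imp (A.sem φ) (B.sem φ)
  | φ, .all s A => .all s fun d : Dom Γ s => A.sem (φ.cons d)

theorem Val.cons_zero {s : Srt} (φ : Val Γ) (d : Dom Γ s) : φ.cons d s 0 = d := by
  simp [Val.cons]

theorem Val.cons_succ {s : Srt} (φ : Val Γ) (d : Dom Γ s) (k : ℕ) :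
    φ.cons d s (k + 1) = φ s k := by
  simp [Val.cons]

theorem Val.cons_of_ne {s s' : Srt} (φ : Val Γ) (d : Dom Γ s) (k : ℕ) (h : s' ≠ s) :
    φ.cons d s' k = φ s' k := by
  simp [Val.cons, h]

theorem Val.cons_shift {s : Srt} (φ : Val Γ) (d : Dom Γ s) (s' : Srt) (k : ℕ) :
    φ.cons d s' (Ren.shift s s' k) = φ s' k := by
  by_cases h : s' = s
  · subst h
    simp [Ren.shift, Val.cons_succ]
  · simp [Ren.shift, h, Val.cons_of_ne]

theorem Form.sem_eps0 (φ : Val Γ) (c : Term L (.kappa 0)) :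
    (Form.eps0 c).sem I φ = (c.sem I φ : (Fin 0 → ℕ) → Cand Γ) fun i => i.elim0 :=
  congrArg (c.sem I φ : (Fin 0 → ℕ) → Cand Γ) (funext fun i => i.elim0)

theorem Term.sem_subst (φ : Val Γ) (θ : Subst L) {s : Srt} (a : Term L s) :
    (a.subst θ).sem I φ = a.sem I (fun s k => (θ s k).sem I φ) := by
  induction a <;> simp_all [Term.subst, Term.sem]

theorem Term.sem_shift {s' : Srt} (φ : Val Γ) (d : Dom Γ s') {s : Srt} (a : Term L s) :
    (a.shift s').sem I (φ.cons d) = a.sem I φ := by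
  rw [Term.shift_eq_subst, Term.sem_subst]
  congr 1
  funext s k
  exact Val.cons_shift φ d s k

theorem Form.sem_subst (φ : Val Γ) (θ : Subst L) (A : Form L) :
    (A.subst θ).sem I φ = A.sem I (fun s k => (θ s k).sem I φ) := by
  induction A generalizing φ θ with
  | all s A ih =>
    simp only [Form.subst, Form.sem, ih]
    congr 1
    funext d
    congr 1
    funext s' k
    by_cases h : s' = s
    · subst h
      cases k <;> simp [Subst.up, Term.sem, Val.cons_zero, Val.cons_succ, Term.sem_shift]
    · simp [Subst.up, h, Val.cons_of_ne, Term.sem_shift]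
  | _ => simp_all [Form.subst, Form.sem, Term.sem_subst]

theorem Form.sem_shift {s : Srt} (φ : Val Γ) (d : Dom Γ s) (A : Form L) :
    (A.shift s).sem I (φ.cons d) = A.sem I φ := by
  rw [Form.shift_eq_subst, Form.sem_subst]
  congr 1
  funext s k
  exact Val.cons_shift φ d s k

theorem Form.sem_inst {s : Srt} (φ : Val Γ) (a : Term L s) (A : Form L) :
    (A.inst a).sem I φ = A.sem I (φ.cons (a.sem I φ)) := by
  rw [Form.inst, Form.sem_subst]
  congr 1
  funext s' k
  by_cases h : s' = s
  · subst h
    cases k <;> simp [Subst.inst, Term.sem, Val.cons_zero, Val.cons_succ]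
  · simp [Subst.inst, h, Term.sem, Val.cons_of_ne]

theorem Term.sem_congr {φ ψ : Val Γ} {s : Srt} (a : Term L s)
    (h : ∀ s k, a.HasFree s k → φ s k = ψ s k) : a.sem I φ = a.sem I ψ := by
  induction a with
  | var s k => exact h s k ⟨rfl, rfl⟩
  | zero => rfl
  | succ a ih => exact congrArg Nat.succ (ih h)
  | pred a ih => exact congrArg Nat.pred (ih h)
  | fn f b ih => exact congrArg (I f) (funext fun j => ih j fun s k hk => h s k ⟨j, hk⟩)

theorem Form.sem_congr {φ ψ : Val Γ} (A : Form L)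
    (h : ∀ s k, A.HasFree s k → φ s k = ψ s k) : A.sem I φ = A.sem I ψ := by
  induction A generalizing φ ψ with
  | eq a b =>
    simp only [Form.sem, a.sem_congr I fun s k hk => h s k (.inl hk),
      b.sem_congr I fun s k hk => h s k (.inr hk)]
  | nat a => simp only [Form.sem, a.sem_congr I h]
  | null a => simp only [Form.sem, a.sem_congr I h]
  | eps n a c =>
    simp only [Form.sem, fun i => (a i).sem_congr I fun s k hk => h s k (.inl ⟨i, hk⟩),
      c.sem_congr I fun s k hk => h s k (.inr hk)]
  | imp A B ihA ihB =>
    exact congrArg₂ Cand.imp (ihA fun s k hk => h s k (.inl hk))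
      (ihB fun s k hk => h s k (.inr hk))
  | all s A ih =>
    refine congrArg (Cand.all s) (funext fun d => ih fun s' k hk => ?_)
    by_cases hs : s' = s
    · subst hs
      cases k with
      | zero => rw [Val.cons_zero, Val.cons_zero]
      | succ k =>
        rw [Val.cons_succ, Val.cons_succ]
        exact h s' k (by simpa [Form.HasFree] using hk)
    · rw [Val.cons_of_ne _ _ _ hs, Val.cons_of_ne _ _ _ hs]
      exact h s' k (by simpa [Form.HasFree, hs] using hk)

end Generic

variable {Γ : Ctx}

/-- The value of a Skolem symbol is the class defined by its proposition.  All assignments with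
the given values of the `x_i` and `y_j` give the proposition the same value, so that taking the
intersection over all of them merely avoids the choice of one. -/
def skolemSem : SymSem Γ haSig := fun f b (v : Fin f.p → ℕ) =>
  Cand.inter {X | ∃ φ : Val Γ, (∀ i, φ .iota (f.x i) = v i) ∧ (∀ j, φ (f.ySort j) (f.y j) = b j) ∧
    X = f.body.sem (fun f => Empty.elim f) φ}

theorem Term.sem_embed (φ : Val Γ) {s : Srt} (a : Term baseSig s) :
    a.embed.sem skolemSem φ = a.sem (fun f => Empty.elim f) φ := by
  induction a with
  | fn f => exact Empty.elim f
  | _ => simp_all [Term.embed, Term.sem]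

theorem Form.sem_embed (φ : Val Γ) (A : Form baseSig) :
    A.embed.sem skolemSem φ = A.sem (fun f => Empty.elim f) φ := by
  induction A generalizing φ <;> simp_all [Form.embed, Form.sem, Term.sem_embed]

theorem skolemSem_apply (f : SkolemSym) (φ : Val Γ) :
    (skolemSem (Γ := Γ) f (fun j => φ (f.ySort j) (f.y j)) : (Fin f.p → ℕ) → Cand Γ)
      (fun i => φ .iota (f.x i)) = f.body.sem (fun f => Empty.elim f) φ := by
  refine Eq.trans (congrArg Cand.inter (Set.ext fun X => ?_)) (Cand.inter_singleton _)
  constructor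
  · rintro ⟨ψ, h₁, h₂, rfl⟩
    refine Form.sem_congr _ _ fun s k hk => ?_
    rcases f.free s k hk with ⟨i, hi⟩ | ⟨j, hj⟩
    · cases hi
      exact h₁ i
    · cases hj
      exact h₂ j
  · rintro rfl
    exact ⟨φ, fun _ => rfl, fun _ => rfl, rfl⟩

theorem TermCongr.sem_eq {s : Srt} {a b : Tm s} (h : TermCongr a b) (φ : Val Γ) :
    a.sem skolemSem φ = b.sem skolemSem φ := by
  induction h with
  | rule h => cases h <;> rfl
  | refl a => rfl
  | symm _ ih => exact ih.symm
  | trans _ _ ih₁ ih₂ => exact ih₁.trans ih₂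
  | succ _ ih => exact congrArg Nat.succ ih
  | pred _ ih => exact congrArg Nat.pred ih
  | fn f _ ih => exact congrArg (skolemSem f) (funext ih)

theorem FormRule.sem_eq {A B : Fm} (h : FormRule A B) (φ : Val Γ) :
    A.sem skolemSem φ = B.sem skolemSem φ := by
  cases h with
  | skolem f θ =>
    rw [Form.sem_subst, Form.sem_embed]
    exact skolemSem_apply f (fun s k => (θ s k).sem skolemSem φ)
  | eq a b =>
    simp only [Form.sem, Form.eps1, Term.sem, Val.cons_zero, Term.sem_shift]
  | nat a =>
    simp only [Form.sem, Form.eps1, Term.sem, Val.cons_zero, Term.sem_shift]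
    rw [← Cand.natOp_natSem]
    rfl
  | null_zero =>
    simp only [Form.sem, Form.sem_eps0, Form.top, Term.sem, Val.cons_zero]
    rfl
  | null_succ a =>
    simp only [Form.sem, Form.sem_eps0, Form.bot, Term.sem, Val.cons_zero]
    rfl

/-- The rewrite rules are valid in the model. -/
theorem FormCongr.sem_eq {A B : Fm} (h : FormCongr A B) (φ : Val Γ) :
    A.sem skolemSem φ = B.sem skolemSem φ := by
  induction h generalizing φ with
  | rule r => exact r.sem_eq φ
  | refl A => rfl
  | symm _ ih => exact (ih φ).symm
  | trans _ _ ih₁ ih₂ => exact (ih₁ φ).trans (ih₂ φ)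
  | eq h₁ h₂ => simp only [Form.sem, h₁.sem_eq, h₂.sem_eq]
  | nat h => simp only [Form.sem, h.sem_eq]
  | null h => simp only [Form.sem, h.sem_eq]
  | eps n h₁ h₂ =>
    simp only [Form.sem, h₂.sem_eq]
    exact congrArg _ (funext fun i => (h₁ i).sem_eq φ)
  | imp _ _ ih₁ ih₂ => simp only [Form.sem, ih₁, ih₂]
  | all s _ ih => simp only [Form.sem, ih]

/-! ### Instances of schemes and the fundamental lemma -/

/-- Values for the canonical variables, carried under `Λ` of sort `s`. -/
def shiftAssign (s : Srt) (P : Fm → Scheme → Prop) : Fm → Scheme → Prop := fun B v =>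
  ∃ A w, B = A.shift s ∧ v = w.shift s ∧ P A w

/-- `t.Inst θ Λ P v`: the scheme `v` is obtained from `t` by applying `θ` to the types and terms,
by leaving some canonical variables whose types are in `Λ` in place, and by replacing every
other canonical variable, of type `A`, by some `w` with `P A w`.  Both the values `P` and the
locally bound types `Λ` refer to the types in `t`, before the application of `θ`: two variables
with distinct types are kept apart even if `θ` identifies these types. -/
def Scheme.Inst : Scheme → Subst haSig → Ctx → (Fm → Scheme → Prop) → Scheme → Prop
  | .var A, θ, Λ, P, v => P A v ∨ (A ∈ Λ ∧ v = .var (A.subst θ))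
  | .lam A t, θ, Λ, P, v => ∃ t', v = .lam (A.subst θ) t' ∧ t.Inst θ (Λ ∪ {A}) P t'
  | .app t u, θ, Λ, P, v => ∃ t' u', v = .app t' u' ∧ t.Inst θ Λ P t' ∧ u.Inst θ Λ P u'
  | .tlam s t, θ, Λ, P, v => ∃ t', v = .tlam s t' ∧
      t.Inst (θ.up s) (Ctx.shift s Λ) (shiftAssign s P) t'
  | .tapp t a, θ, Λ, P, v => ∃ t', v = .tapp t' (a.subst θ) ∧ t.Inst θ Λ P t'

theorem shiftAssign_scoped {s : Srt} {P : Fm → Scheme → Prop} {Δ : Ctx}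
    (hP : ∀ B w, P B w → w.Scoped Δ) (B : Fm) (w : Scheme) (h : shiftAssign s P B w) :
    w.Scoped (Ctx.shift s Δ) := by
  obtain ⟨A, v, rfl, rfl, h⟩ := h
  exact (hP A v h).shift s

theorem Ctx.image_subst_subset_up {s : Srt} {θ : Subst haSig} {Λ Δ : Ctx}
    (h : Λ.image (Form.subst θ) ⊆ Δ) :
    (Ctx.shift s Λ).image (Form.subst (θ.up s)) ⊆ Ctx.shift s Δ := by
  rw [Ctx.shift_image_up]
  exact Finset.image_subset_image h

theorem Ctx.image_subst_subset_union {θ : Subst haSig} {Λ Δ : Ctx}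
    (h : Λ.image (Form.subst θ) ⊆ Δ) (A : Fm) :
    (Λ ∪ {A}).image (Form.subst θ) ⊆ Δ ∪ {A.subst θ} := by
  rw [Finset.image_union, Finset.image_singleton]
  exact Finset.union_subset_union_left h

theorem Scheme.Inst.scoped {t v : Scheme} {θ : Subst haSig} {Λ Δ : Ctx}
    {P : Fm → Scheme → Prop} (h : t.Inst θ Λ P v) (hP : ∀ B w, P B w → w.Scoped Δ)
    (hΛ : Λ.image (Form.subst θ) ⊆ Δ) : v.Scoped Δ := by
  induction t generalizing θ Λ Δ P v with
  | var A =>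
    rcases h with h | ⟨h, rfl⟩
    · exact hP _ _ h
    · exact hΛ (Finset.mem_image_of_mem _ h)
  | lam A t ih =>
    obtain ⟨t', rfl, h⟩ := h
    change t'.Scoped _
    exact ih h (fun B w hw => (hP B w hw).mono Finset.subset_union_left)
      (Ctx.image_subst_subset_union hΛ A)
  | app t u iht ihu =>
    obtain ⟨t', u', rfl, ht, hu⟩ := h
    exact ⟨iht ht hP hΛ, ihu hu hP hΛ⟩
  | tlam s t ih =>
    obtain ⟨t', rfl, h⟩ := h
    change t'.Scoped _
    exact ih h (shiftAssign_scoped hP) (Ctx.image_subst_subset_up hΛ)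
  | tapp t a ih =>
    obtain ⟨t', rfl, h⟩ := h
    change t'.Scoped _
    exact ih h hP hΛ

/-- Substituting `τ` in an instance yields an instance. -/
theorem Scheme.Inst.subst {t v : Scheme} {θ τ : Subst haSig} {Λ : Ctx}
    {P P' : Fm → Scheme → Prop} (h : t.Inst θ Λ P v) (hP : ∀ B w, P B w → P' B (w.subst τ)) :
    t.Inst (θ.comp τ) Λ P' (v.subst τ) := by
  induction t generalizing θ τ Λ P P' v with
  | var A =>
    rcases h with h | ⟨h, rfl⟩
    · exact .inl (hP _ _ h)
    · exact .inr ⟨h, congrArg Scheme.var (Form.subst_subst _ _ _)⟩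
  | lam A t ih =>
    obtain ⟨t', rfl, h⟩ := h
    exact ⟨_, by rw [← Form.subst_subst]; rfl, ih h hP⟩
  | app t u iht ihu =>
    obtain ⟨t', u', rfl, ht, hu⟩ := h
    exact ⟨_, _, rfl, iht ht hP, ihu hu hP⟩
  | tlam s t ih =>
    obtain ⟨t', rfl, h⟩ := h
    refine ⟨_, rfl, ?_⟩
    rw [← Subst.up_comp]
    refine ih h ?_
    rintro _ _ ⟨A, w, rfl, rfl, hw⟩
    exact ⟨A, w.subst τ, rfl, Scheme.shift_subst_up s τ w, hP A w hw⟩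
  | tapp t a ih =>
    obtain ⟨t', rfl, h⟩ := h
    exact ⟨_, by rw [← Term.subst_subst]; rfl, ih h hP⟩

/-- The choice of replacements in a β-step: those of the occurrences that stem from the
bound variable of type `A`, and no others, are replaced by `u`.  The replacement of an occurrence
left in place is optional, because its type is in the current context. -/
theorem Scheme.Inst.exists_gsubst {t v u : Scheme} {θ : Subst haSig} {A : Fm} {Λ Δ : Ctx}
    {P : Fm → Scheme → Prop} (h : t.Inst θ (Λ ∪ {A}) P v) (hu : P A u)
    (hP : ∀ B w, P B w → w.Scoped Δ) (hΛ : Λ.image (Form.subst θ) ⊆ Δ) :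
    ∃ v' ∈ v.gsubst u (A.subst θ) Δ, t.Inst θ Λ P v' := by
  induction t generalizing θ A Λ Δ P v u with
  | var B =>
    rcases h with h | ⟨h, rfl⟩
    · exact ⟨v, (hP _ _ h).mem_gsubst_self _ _, .inl h⟩
    · rcases Finset.mem_union.1 h with h | h
      · have hB : Scheme.Scoped (.var (B.subst θ)) Δ := hΛ (Finset.mem_image_of_mem _ h)
        exact ⟨_, hB.mem_gsubst_self _ _, .inr ⟨h, rfl⟩⟩
      · obtain rfl := Finset.mem_singleton.1 h
        exact ⟨u, .inl ⟨rfl, rfl⟩, .inl hu⟩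
  | lam B t ih =>
    obtain ⟨t', rfl, h⟩ := h
    rw [Finset.union_right_comm] at h
    obtain ⟨v', hv, h'⟩ := ih h hu (fun B w hw => (hP B w hw).mono Finset.subset_union_left)
      (Ctx.image_subst_subset_union hΛ B)
    exact ⟨_, ⟨v', hv, rfl⟩, v', rfl, h'⟩
  | app t u iht ihu =>
    obtain ⟨t', u', rfl, h₁, h₂⟩ := h
    obtain ⟨v₁, hv₁, h₁'⟩ := iht h₁ hu hP hΛ
    obtain ⟨v₂, hv₂, h₂'⟩ := ihu h₂ hu hP hΛ
    exact ⟨_, ⟨v₁, hv₁, v₂, hv₂, rfl⟩, v₁, v₂, rfl, h₁', h₂'⟩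
  | tlam s t ih =>
    obtain ⟨t', rfl, h⟩ := h
    rw [Ctx.shift_union_singleton] at h
    obtain ⟨v', hv, h'⟩ := ih h ⟨A, u, rfl, rfl, hu⟩ (shiftAssign_scoped hP)
      (Ctx.image_subst_subset_up hΛ)
    rw [Form.shift_subst_up] at hv
    exact ⟨_, ⟨v', hv, rfl⟩, v', rfl, h'⟩
  | tapp t a ih =>
    obtain ⟨t', rfl, h⟩ := h
    obtain ⟨v', hv, h'⟩ := ih h hu hP hΛ
    exact ⟨_, ⟨v', hv, rfl⟩, v', rfl, h'⟩

theorem Scheme.Scoped.inst_self {t : Scheme} {Λ : Ctx} {P : Fm → Scheme → Prop}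
    (h : t.Scoped Λ) : t.Inst (fun s k => .var s k) Λ P t := by
  induction t generalizing Λ P with
  | var A => exact .inr ⟨h, congrArg Scheme.var (Form.subst_var A).symm⟩
  | lam A t ih => exact ⟨t, by rw [Form.subst_var], ih h⟩
  | app t u iht ihu => exact ⟨t, u, rfl, iht h.1, ihu h.2⟩
  | tlam s t ih => exact ⟨t, rfl, by rw [Subst.up_var]; exact ih h⟩
  | tapp t a ih => exact ⟨t, by rw [Term.subst_var], ih h⟩

/-- The fundamental lemma: an instance of a scheme of type `A`, whose canonical variables have been
replaced by elements of the values of their types, is an element of the value of `A`.  The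
substitution `θ` and the assignment `φ` are independent. -/
theorem HasType.inst_mem_sem {Γ Δ : Ctx} {t : Scheme} {A : Fm} (h : HasType Δ t A) (φ : Val Γ)
    (θ : Subst haSig) (v : Scheme)
    (hv : t.Inst θ ∅ (fun B w => w ∈ B.sem skolemSem φ) v) : v ∈ A.sem skolemSem φ := by
  have hscoped (φ : Val Γ) (B : Fm) (w : Scheme) (h : w ∈ B.sem skolemSem φ) : w.Scoped Γ :=
    (B.sem skolemSem φ).isScoped w h
  induction h generalizing φ θ v with
  | ax _ =>
    rcases hv with h | ⟨h, _⟩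
    · exact h
    · exact absurd h (Finset.notMem_empty _)
  | @lam Δ A B t _ ih =>
    have hs := hv.scoped (hscoped φ) (Finset.empty_subset Γ)
    obtain ⟨t', rfl, h⟩ := hv
    refine ⟨hs, fun u hu => ?_⟩
    obtain ⟨v', hv', h'⟩ := h.exists_gsubst hu (hscoped φ) (Finset.empty_subset Γ)
    exact (B.sem skolemSem φ).expand (.app _ u) _ ⟨hs, hscoped φ A u hu⟩ (.beta hv') (ih φ θ v' h')
  | app _ _ ih₁ ih₂ =>
    obtain ⟨t', u', rfl, h₁, h₂⟩ := hv
    exact (ih₁ φ θ _ h₁).2 _ (ih₂ φ θ _ h₂)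
  | @tlam Δ s A t _ ih =>
    have hs := hv.scoped (hscoped φ) (Finset.empty_subset Γ)
    obtain ⟨t', rfl, h⟩ := hv
    refine ⟨hs, fun a d => (A.sem skolemSem (φ.cons d)).expand (.tapp _ a) _ hs (.tbeta a) ?_⟩
    refine ih (φ.cons d) ((θ.up s).comp (Subst.inst a)) _ (h.subst ?_)
    rintro _ _ ⟨B, w, rfl, rfl, hw⟩
    rw [Form.sem_shift]
    have hw' : (w.shift s).subst (Subst.inst a) = w := Scheme.shift_inst a w
    rwa [hw']
  | @tapp Δ s A t a _ ih =>
    obtain ⟨t', rfl, h⟩ := hv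
    rw [Form.sem_inst]
    exact (ih φ θ _ h).2 _ _
  | conv _ hc ih => exact hc.sem_eq φ ▸ ih φ θ v hv

theorem HasType.mem_sem {Γ : Ctx} {t : Scheme} {A : Fm} (h : HasType ∅ t A) (φ : Val Γ) :
    t ∈ A.sem skolemSem φ :=
  h.inst_mem_sem φ _ t h.scoped.inst_self

/-- The schemes that reduce to some `(g a u)`. -/
def witnessCand (s : Srt) (G : Fm) : Cand {G} where
  carrier := {t | t.Scoped {G} ∧
    ∃ (a : Tm s) (u : Scheme), BetaRed {G} t (.app (.tapp (.var G) a) u)}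
  isScoped _ h := h.1
  expand _ _ ht hs h := ⟨ht, h.2.imp fun _ h => h.imp fun _ h => .head hs h⟩

/-- The quantified class variable of `∃x A` is interpreted by the set of schemes that reduce to
some `(g a u)`: then `g` is in the value of `∀x (A ⇒ ε_0(c))`. -/
theorem HasType.betaRed_witness {s : Srt} {A : Fm} {t : Scheme} (h : HasType ∅ t (Form.ex s A))
    (e : Tm (.kappa 0)) (G : Fm) :
    ∃ (a : Tm s) (u : Scheme),
      BetaRed {G} (.app (.tapp t e) (.var G)) (.app (.tapp (.var G) a) u) := by
  let d : Dom {G} (.kappa 0) := fun _ => witnessCand s G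
  -- the values of the free variables are immaterial
  let φ : Val {G} := fun s _ => match s with
    | .iota => (0 : ℕ)
    | .kappa _ => fun _ => witnessCand .iota G
  have h₁ := (h.mem_sem φ).2 e d
  have hG : Scheme.Scoped (.var G) {G} := Finset.mem_singleton_self G
  have hc (b : Dom {G} s) : ((Form.eps0 (.var (.kappa 0) 0) : Fm).shift s).sem skolemSem
      ((φ.cons d).cons b) = witnessCand s G := by
    rw [Form.sem_shift, Form.sem_eps0, Term.sem, Val.cons_zero]
  refine (h₁.2 (.var G) ⟨hG, fun a b => ⟨hG, fun u hu => ?_⟩⟩).2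
  rw [hc]
  exact ⟨⟨hG, Cand.isScoped _ u hu⟩, a, u, .refl⟩

/-! ### Class terms for arbitrary propositions -/

theorem Term.exists_embed (a : Tm .iota) : ∃ a₀ : Term baseSig .iota, a₀.embed = a := by
  suffices ∀ {s : Srt} (a : Tm s), s = .iota → ∃ a₀ : Term baseSig s, a₀.embed = a from this a rfl
  intro s a hs
  induction a with
  | var s k => exact ⟨.var s k, rfl⟩
  | zero => exact ⟨.zero, rfl⟩
  | succ a ih =>
    obtain ⟨a₀, rfl⟩ := ih rfl
    exact ⟨.succ a₀, rfl⟩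
  | pred a ih =>
    obtain ⟨a₀, rfl⟩ := ih rfl
    exact ⟨.pred a₀, rfl⟩
  | fn f b => cases hs

/-- Membership in the class `c`, and in all renamings of `c`, is congruent to a proposition
without Skolem symbols.  Nothing is required of a number. -/
def Expressible : {s : Srt} → Tm s → Prop
  | .iota, _ => True
  | .kappa n, c => ∀ (ρ : Ren) (a : Fin n → Tm .iota),
      ∃ B : Form baseSig, FormCongr (.eps n a (c.rename ρ)) B.embed

theorem Term.rename_rename {L : ClassSig} (ρ τ : Ren) {s : Srt} (a : Term L s) :
    (a.rename ρ).rename τ = a.rename (fun s k => τ s (ρ s k)) := by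
  induction a <;> simp_all [Term.rename]

theorem Expressible.shift {s' : Srt} (s : Srt) {c : Tm s'} (h : Expressible c) :
    Expressible (c.shift s) := by
  cases s' with
  | iota => trivial
  | kappa n =>
    intro ρ a
    rw [Term.shift, Term.rename_rename]
    exact h _ a

theorem Expressible.var (s : Srt) (k : ℕ) : Expressible (.var s k : Tm s) := by
  cases s with
  | iota => trivial
  | kappa n =>
    intro ρ a
    choose a₀ ha using fun i => Term.exists_embed (a i)
    refine ⟨.eps n a₀ (.var (.kappa n) (ρ (.kappa n) k)), ?_⟩
    simp only [Form.embed, ha]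
    exact .refl _

theorem Expressible.up {θ : Subst haSig} (h : ∀ s k, Expressible (θ s k)) (s : Srt) :
    ∀ s' k, Expressible (θ.up s s' k) := by
  intro s' k
  by_cases hs : s' = s
  · subst hs
    cases k with
    | zero => simpa [Subst.up] using Expressible.var s' 0
    | succ k => simpa [Subst.up] using (h s' k).shift s'
  · simpa [Subst.up, hs] using (h s' k).shift s

theorem Term.rename_id {L : ClassSig} {s : Srt} (a : Term L s) :
    a.rename (fun _ k => k) = a := by
  induction a <;> simp_all [Term.rename]

theorem Form.exists_embed_of_subst (A : Form baseSig) {θ : Subst haSig}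
    (h : ∀ s k, Expressible (θ s k)) :
    ∃ B : Form baseSig, FormCongr (A.embed.subst θ) B.embed := by
  induction A generalizing θ with
  | eq a b =>
    obtain ⟨a₀, ha⟩ := Term.exists_embed (a.embed.subst θ)
    obtain ⟨b₀, hb⟩ := Term.exists_embed (b.embed.subst θ)
    refine ⟨.eq a₀ b₀, ?_⟩
    simp only [Form.embed, Form.subst, ha, hb]
    exact .refl _
  | nat a =>
    obtain ⟨a₀, ha⟩ := Term.exists_embed (a.embed.subst θ)
    refine ⟨.nat a₀, ?_⟩
    simp only [Form.embed, Form.subst, ha]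
    exact .refl _
  | null a =>
    obtain ⟨a₀, ha⟩ := Term.exists_embed (a.embed.subst θ)
    refine ⟨.null a₀, ?_⟩
    simp only [Form.embed, Form.subst, ha]
    exact .refl _
  | eps n a c =>
    cases c with
    | var _ k =>
      obtain ⟨B, hB⟩ := h (.kappa n) k (fun _ k => k) fun i => (a i).embed.subst θ
      rw [Term.rename_id] at hB
      exact ⟨B, hB⟩
    | fn f => exact Empty.elim f
  | imp A B ihA ihB =>
    obtain ⟨A₀, hA⟩ := ihA h
    obtain ⟨B₀, hB⟩ := ihB h
    exact ⟨.imp A₀ B₀, .imp hA hB⟩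
  | all s A ih =>
    obtain ⟨A₀, hA⟩ := ih (Expressible.up h s)
    exact ⟨.all s A₀, .all s hA⟩

/-- A substitution with given values at pairwise distinct variables. -/
theorem Subst.exists_extend {I : Type} {idx : I → Srt × ℕ} (hinj : Function.Injective idx)
    (val : (i : I) → Tm (idx i).1) :
    ∃ θ : Subst haSig, (∀ i, θ (idx i).1 (idx i).2 = val i) ∧
      ∀ s k, (∃ i, idx i = (s, k)) ∨ θ s k = .var s k := by
  classical
  refine ⟨fun s k => if h : ∃ i, idx i = (s, k) then
    (show (idx h.choose).1 = s from congrArg Prod.fst h.choose_spec) ▸ val h.choose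
    else .var s k, fun i => ?_, fun s k => ?_⟩
  · have h : ∃ j, idx j = ((idx i).1, (idx i).2) := ⟨i, rfl⟩
    have key : ∀ (j : I) (hj : idx j = idx i),
        ((congrArg Prod.fst hj) ▸ val j : Tm (idx i).1) = val i := by
      intro j hj
      obtain rfl := hinj hj
      rfl
    simp only [dif_pos h]
    exact key _ h.choose_spec
  · by_cases h : ∃ i, idx i = (s, k)
    · exact .inl h
    · exact .inr (by simp only [dif_neg h])

theorem Expressible.all {s : Srt} (c : Tm s) : Expressible c := by
  induction c with
  | var s k => exact .var s k
  | zero => trivial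
  | succ a => trivial
  | pred a => trivial
  | fn f b ih =>
    intro ρ a
    -- the parameters of `f` have to be renamed, and renamings preserve expressibility
    have hren {s : Srt} {c : Tm s} (h : Expressible c) : Expressible (c.rename ρ) := by
      cases s with
      | iota => trivial
      | kappa n =>
        intro τ a
        rw [Term.rename_rename]
        exact h _ a
    obtain ⟨θ, hθ, hvar⟩ := Subst.exists_extend f.distinct
      (fun i => match i with
        | .inl i => a i
        | .inr j => (b j).rename ρ)
    have hexp : ∀ s k, Expressible (θ s k) := by
      intro s k
      rcases hvar s k with ⟨i | j, hi⟩ | h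
      · cases hi
        trivial
      · cases hi
        exact (hθ (.inr j)).symm ▸ hren (ih j)
      · exact h.symm ▸ .var s k
    obtain ⟨B, hB⟩ := f.body.exists_embed_of_subst hexp
    refine ⟨B, FormCongr.trans ?_ hB⟩
    have h₁ : (fun i => θ .iota (f.x i)) = a := funext fun i => hθ (.inl i)
    have h₂ : (fun j => θ (f.ySort j) (f.y j)) = fun j => (b j).rename ρ :=
      funext fun j => hθ (.inr j)
    have h₃ := congrArg₂ (fun x y => Form.eps f.p x (Term.fn (L := haSig) f y)) h₁ h₂
    exact .rule (h₃ ▸ FormRule.skolem f θ)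

/-- Every proposition is congruent to one without Skolem symbols. -/
theorem Form.exists_embed_congr (A : Fm) : ∃ B : Form baseSig, FormCongr A B.embed := by
  induction A with
  | eq a b =>
    obtain ⟨a₀, rfl⟩ := Term.exists_embed a
    obtain ⟨b₀, rfl⟩ := Term.exists_embed b
    exact ⟨.eq a₀ b₀, .refl _⟩
  | nat a =>
    obtain ⟨a₀, rfl⟩ := Term.exists_embed a
    exact ⟨.nat a₀, .refl _⟩
  | null a =>
    obtain ⟨a₀, rfl⟩ := Term.exists_embed a
    exact ⟨.null a₀, .refl _⟩
  | eps n a c =>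
    have := Expressible.all c (fun _ k => k) a
    rwa [Term.rename_id] at this
  | imp A B ihA ihB =>
    obtain ⟨A₀, hA⟩ := ihA
    obtain ⟨B₀, hB⟩ := ihB
    exact ⟨.imp A₀ B₀, .imp hA hB⟩
  | all s A ih =>
    obtain ⟨A₀, hA⟩ := ih
    exact ⟨.all s A₀, .all s hA⟩

theorem Term.finite_hasFree {L : ClassSig} {s : Srt} (a : Term L s) :
    {q : Srt × ℕ | a.HasFree q.1 q.2}.Finite := by
  induction a with
  | var s k =>
    refine (Set.finite_singleton (s, k)).subset ?_
    rintro ⟨s', k'⟩ ⟨rfl, rfl⟩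
    rfl
  | zero => exact Set.finite_empty
  | succ a ih => exact ih
  | pred a ih => exact ih
  | fn f b ih => exact (Set.finite_iUnion ih).subset fun q ⟨j, hj⟩ => Set.mem_iUnion.2 ⟨j, hj⟩

theorem Form.finite_hasFree {L : ClassSig} (A : Form L) :
    {q : Srt × ℕ | A.HasFree q.1 q.2}.Finite := by
  induction A with
  | eq a b => exact a.finite_hasFree.union b.finite_hasFree
  | nat a => exact a.finite_hasFree
  | null a => exact a.finite_hasFree
  | eps n a c =>
    refine ((Set.finite_iUnion fun i => (a i).finite_hasFree).union c.finite_hasFree).subset ?_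
    rintro q (⟨i, hi⟩ | h)
    · exact .inl (Set.mem_iUnion.2 ⟨i, hi⟩)
    · exact .inr h
  | imp A B ihA ihB => exact ihA.union ihB
  | all s A ih =>
    refine ih.preimage (f := fun q : Srt × ℕ => (q.1, if q.1 = s then q.2 + 1 else q.2))
      (Function.Injective.injOn ?_)
    rintro ⟨s₁, k₁⟩ ⟨s₂, k₂⟩ h
    simp only [Prod.mk.injEq] at h
    obtain ⟨rfl, h⟩ := h
    split_ifs at h <;> simp_all

/-- Comprehension for classes of arity `0`. -/
theorem FormCongr.exists_eps0 (A : Fm) : ∃ e : Tm (.kappa 0), FormCongr (.eps0 e) A := by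
  obtain ⟨B, hB⟩ := Form.exists_embed_congr A
  -- the parameters of the Skolem symbol are all the free variables of `B`
  let F := B.finite_hasFree.toFinset
  let q (j : Fin F.card) : Srt × ℕ := (F.equivFin.symm j).1
  have hq : Function.Injective q := Subtype.val_injective.comp F.equivFin.symm.injective
  let f : SkolemSym :=
    { p := 0
      n := F.card
      x := fun i => i.elim0
      ySort := fun j => (q j).1
      y := fun j => (q j).2
      body := B
      distinct := by
        rintro (i | j) (i' | j') h
        · exact i.elim0
        · exact i.elim0
        · exact i'.elim0
        · exact congrArg Sum.inr (hq h)
      free := fun s k h => by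
        refine .inr ⟨F.equivFin ⟨(s, k), B.finite_hasFree.mem_toFinset.2 h⟩, ?_⟩
        simp [q] }
  refine ⟨Term.fn (L := haSig) f fun j => .var _ (f.y j), FormCongr.trans ?_ hB.symm⟩
  have h := FormRule.skolem f fun s k => .var s k
  rw [Form.subst_var] at h
  have hx : (fun i => .var .iota (f.x i) : Fin f.p → Tm .iota) = fun i => i.elim0 :=
    funext fun i => i.elim0
  rw [hx] at h
  exact .rule h

/-! ### Extraction of witnesses -/

theorem Form.Closed.hasFree_of_ex {L : ClassSig} {s : Srt} {A : Form L} (hA : (Form.ex s A).Closed)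
    (s' : Srt) (k : ℕ) (h : A.HasFree s' k) : s' = s ∧ k = 0 := by
  have key (m : ℕ) (h : (A.rename (Ren.up s (Ren.shift (.kappa 0)))).HasFree s'
      (if s' = s then Ren.shift (.kappa 0) s' m + 1 else Ren.shift (.kappa 0) s' m)) : False :=
    hA s' m (.inl (.inl h))
  have h' := h.rename (ρ := Ren.up s (Ren.shift (.kappa 0)))
  by_cases hs : s' = s
  · cases k with
    | zero => exact ⟨hs, rfl⟩
    | succ k =>
      refine (key k ?_).elim
      simpa [Ren.up, hs] using h'
  · refine (key k ?_).elim
    simpa [Ren.up, hs] using h'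

theorem Form.allImp_subst {L : ClassSig} (s : Srt) (A D : Form L) (θ : Subst L) :
    (Form.allImp s A D).subst θ = .allImp s (A.subst (θ.up s)) (D.subst θ) := by
  rw [Form.allImp, Form.subst, Form.subst, Form.shift_subst_up, Form.allImp]

theorem Form.Closed.subst_up {s : Srt} {A : Fm} (hA : (Form.ex s A).Closed)
    (θ : Subst haSig) : A.subst (θ.up s) = A := by
  refine (A.subst_congr fun s' k h => ?_).trans A.subst_var
  obtain ⟨rfl, rfl⟩ := hA.hasFree_of_ex s' k h
  simp [Subst.up]

/-- The instance of `∃x A` at a class term, for closed `∃x A`. -/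
theorem Form.Closed.hasType_tapp {s : Srt} {A : Fm} (hA : (Form.ex s A).Closed) {Γ : Ctx}
    {t : Scheme} (ht : HasType Γ t (.ex s A))
    (e : Tm (.kappa 0)) :
    HasType Γ (.tapp t e) (.imp (.allImp s A (.eps0 e)) (.eps0 e)) := by
  have h := HasType.tapp e ht
  rw [Form.inst, Form.subst, Form.allImp_subst, Form.rename_eq_subst, ← Subst.up_ofRen,
    hA.subst_up, hA.subst_up, Form.eps0_subst] at h
  have he : (Term.var (.kappa 0) 0 : Tm (.kappa 0)).subst (Subst.inst e) = e := by
    simp [Term.subst, Subst.inst]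
  rwa [he] at h

/-- The introduction rule of `∃x A` as a closed scheme. -/
theorem Form.Closed.exists_hasType_intro {s : Srt} {A : Fm} (hA : (Form.ex s A).Closed) :
    ∃ w : Scheme, HasType ∅ w (.allImp s A (.ex s A)) := by
  let x : Tm s := .var s (Ren.shift (.kappa 0) s 0)
  have hx : A.shift (.kappa 0) = A.inst x := by
    rw [Form.shift_eq_subst]
    refine A.subst_congr fun s' k h => ?_
    obtain ⟨rfl, rfl⟩ := hA.hasFree_of_ex s' k h
    simp [Subst.ofRen, Subst.inst, x]
  have hex : (Form.ex s A).shift s =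
      .all (.kappa 0) (.imp (.allImp s A (.eps0 (.var _ 0))) (.eps0 (.var _ 0))) := by
    have hE : (Form.eps0 (.var (.kappa 0) 0) : Fm).subst
        (Subst.up (.kappa 0) (Subst.ofRen (Ren.shift s))) = .eps0 (.var _ 0) := by
      rw [Form.eps0_subst]
      simp [Term.subst, Subst.up]
    rw [Form.shift_eq_subst, Form.ex, Form.subst, Form.subst, Form.allImp_subst, hE,
      Form.rename_eq_subst, ← Subst.up_ofRen, hA.subst_up, hA.subst_up]
  let H : Fm := .allImp s A (.eps0 (.var _ 0))
  refine ⟨.tlam s (.lam A (.tlam (.kappa 0) (.lam H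
    (.app (.tapp (.var H) x) (.var (A.shift (.kappa 0))))))), .tlam (.lam ?_)⟩
  rw [hex]
  refine .tlam (.lam ?_)
  have h₁ : HasType (Ctx.shift (.kappa 0) (Ctx.shift s ∅ ∪ {A}) ∪ {H}) (.tapp (.var H) x)
      (.imp (A.inst x) (.eps0 (.var _ 0))) := by
    have h := HasType.tapp (A := .imp A ((Form.eps0 (.var (.kappa 0) 0)).shift s)) x
      (HasType.ax (Γ := Ctx.shift (.kappa 0) (Ctx.shift s ∅ ∪ {A}) ∪ {H}) (A := H)
        (Finset.mem_union_right _ (Finset.mem_singleton_self _)))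
    have hs := Form.shift_inst x (Form.eps0 (.var (.kappa 0) 0))
    rw [Form.inst] at hs
    rwa [Form.inst, Form.subst, hs] at h
  refine .app h₁ ?_
  rw [← hx]
  exact .ax (Finset.mem_union_left _ (Finset.mem_image_of_mem _
    (Finset.mem_union_right _ (Finset.mem_singleton_self _))))

/-- Closing a proof of `[a/x]A` from `∀x (A ⇒ ε_0(c))`: the class `e` of `∃x A` is substituted for
`c`, and the hypothesis, which becomes congruent to the introduction rule of `∃x A`, is
replaced by a proof of this rule. -/
theorem Form.Closed.hasType_extraction {s : Srt} {A : Fm} (hA : (Form.ex s A).Closed)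
    {c : ℕ} {a : Tm s} {u w : Scheme} {e : Tm (.kappa 0)}
    (hu : HasType {Form.allImp s A (.eps0 (.var _ c))} u (A.inst a))
    (he : FormCongr (.eps0 e) (.ex s A)) (hw : HasType ∅ w (.allImp s A (.ex s A))) :
    HasType ∅ ((u.subst (Subst.single c e)).minSubst w (.allImp s A (.eps0 e)) ∅)
      (A.inst (a.subst (Subst.single c e))) := by
  have h := hu.subst (Subst.single c e)
  have hc : (Term.var (.kappa 0) c : Tm (.kappa 0)).subst (Subst.single c e) = e := by
    simp [Term.subst, Subst.single]
  rw [Finset.image_singleton, Form.allImp_subst, Form.inst_subst, hA.subst_up, Form.eps0_subst,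
    hc] at h
  refine h.gsubst (Finset.subset_union_right) (hw.conv ?_) (Scheme.minSubst_mem_gsubst _ _ _ _)
  refine .all s (.imp (.refl _) ?_)
  rw [Form.shift_eq_subst, Form.shift_eq_subst]
  exact he.symm.subst _

end SchemeHA2

open SchemeHA2 in
theorem mainTheorem5 (s : Srt) (A : Fm) (hA : (Form.ex s A).Closed) (t : Scheme)
    (ht : HasType ∅ t (Form.ex s A)) :
    -- the witness property
    (∃ (b : Tm s) (v : Scheme), HasType ∅ v (A.inst b)) ∧
    -- the class term `e` and the closed proof `w` used in the extraction exist
    (∃ e : Tm (.kappa 0), FormCongr (Form.eps0 e) (Form.ex s A)) ∧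
    (∃ w : Scheme, HasType ∅ w (Form.allImp s A (Form.ex s A))) ∧
    -- the extraction: `c` is a variable of sort `κ_0`, `G = ∀x (A ⇒ ε_0(c))`, `g = [G]`
    ∀ (c : ℕ) (G : Fm), G = Form.allImp s A (Form.eps0 (.var (.kappa 0) c)) →
      (∃ (a : Tm s) (u : Scheme),
        BetaRed {G} (.app (.tapp t (.var (.kappa 0) c : Tm (.kappa 0))) (.var G))
          (.app (.tapp (.var G) a) u)) ∧
      (∀ n : Scheme,
        IsWeakNF {G} (.app (.tapp t (.var (.kappa 0) c : Tm (.kappa 0))) (.var G)) n →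
        ∃ (a : Tm s) (u : Scheme), n = .app (.tapp (.var G) a) u) ∧
      (∀ (a : Tm s) (u n : Scheme), n = .app (.tapp (.var G) a) u →
        (BetaRed {G} (.app (.tapp t (.var (.kappa 0) c : Tm (.kappa 0))) (.var G)) n ∨
          IsWeakNF {G} (.app (.tapp t (.var (.kappa 0) c : Tm (.kappa 0))) (.var G)) n) →
        HasType {G} u (A.inst a) ∧
        ∀ (e : Tm (.kappa 0)) (w : Scheme),
          FormCongr (Form.eps0 e) (Form.ex s A) →
          HasType ∅ w (Form.allImp s A (Form.ex s A)) →
          HasType ∅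
            ((u.subst (Subst.single c e)).minSubst w (Form.allImp s A (Form.eps0 e)) ∅)
            (A.inst (a.subst (Subst.single c e)))) := by
  have htype (c : ℕ) : HasType {Form.allImp s A (.eps0 (.var _ c))}
      (.app (.tapp t (.var (.kappa 0) c : Tm (.kappa 0)))
        (.var (.allImp s A (.eps0 (.var _ c))))) (.eps0 (.var _ c)) :=
    .app (hA.hasType_tapp (ht.weaken (Finset.empty_subset _)) _)
      (.ax (Finset.mem_singleton_self _))
  obtain ⟨e, he⟩ := FormCongr.exists_eps0 (Form.ex s A)
  obtain ⟨w, hw⟩ := hA.exists_hasType_intro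
  refine ⟨?_, ⟨e, he⟩, ⟨w, hw⟩, ?_⟩
  · obtain ⟨a, u, h⟩ := ht.betaRed_witness (.var _ 0) (.allImp s A (.eps0 (.var _ 0)))
    exact ⟨_, _, hA.hasType_extraction ((h.hasType (htype 0)).witness rfl) he hw⟩
  · rintro c G rfl
    refine ⟨ht.betaRed_witness _ _, ?_, ?_⟩
    · rintro n ⟨hn, hnf⟩
      exact (hn.betaRed.hasType (htype c)).weak_normal_eps0 rfl hnf
    · rintro a u n rfl h
      have hu := ((h.elim id fun h => h.1.betaRed).hasType (htype c)).witness rfl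
      exact ⟨hu, fun e w he hw => hA.hasType_extraction hu he hw⟩
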